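/- **Notation.** Let $d\in\mathbb N$ and let $(\rho_i)_{i\ge -1}$ be a dyadic partition of unity of $\mathbb R^d$: the functions $\rho_i:\mathbb R^d\to[0,1]$ are smooth, radial and compactly supported, $\operatorname{supp}\rho_{-1}\subset\{|x|<\tfrac43\}$, $\operatorname{supp}\rho_0\subset\{\tfrac34<|x|<\tfrac83\}$, $\rho_i=\rho_0(2^{-i}\,\cdot)$ for $i\ge0$, and $\sum_{i\ge-1}\rho_i=1$. With $\mathscr F\varphi(\xi)=\int\varphi(x)e^{-2\pi \mathrm i\langle x,\xi\rangle}dx$, set $Q_i=\mathscr F^{-1}\rho_i$, $\Delta_if=\mathscr F^{-1}(\rho_i\mathscr Ff)$ for $f\in\mathcal S'(\mathbb R^d)$, and $P_j=\sum_{-1\le i\le j-2}Q_i$ (so $P_j=0$ for $j\le0$). For $\alpha\in\mathbb R$ let $\|f\|_{\mathcal C^\alpha}=\sup_{i\ge-1}2^{\alpha i}\|\Delta_if\|_{L^\infty}$ and $\mathcal C^\alpha(\mathbb R^d)=\{f\in\mathcal S'(\mathbb R^d):\|f\|_{\mathcal C^\alpha}<\infty\}$. For a family $\Lambda=(\Lambda_x)_{x\in\mathbb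 R^d}$ of tempered distributions let $$\mathbf P(\Lambda)=\sum_{j\ge1}\mathbf Q_j\Lambda,\qquad (\mathbf Q_j\Lambda)(x)=\int P_j(x-y)\,\langle\Lambda_y,Q_j(x-\cdot)\rangle\,dy ,$$ the series being taken in $\mathcal S'(\mathbb R^d)$. **Proposition.** Let $\gamma,\beta_0\in\mathbb R$ and let $(\Lambda_x)_{x\in\mathbb R^d}$ be tempered distributions on $\mathbb R^d$ with $\sup_x\|\Lambda_x\|_{\mathcal C^{\beta_0}}<\infty$. Assume that, for some finite $N$, for all $x,y\in\mathbb R^d$, $$\Lambda_y-\Lambda_x=\sum_{\ell=1}^N c^\ell_{yx}\,\Theta^\ell_x ,$$ where $\Theta^\ell_x$ are tempered distributions and the coefficients $c^\ell_{yx}\in\mathbb R$ depend measurably on $(y,x)$, and that there are exponents $\beta_\ell<\gamma$ such that, for each $1\le\ell\le N$, $$\sup_{x\in\mathbb R^d}\sup_{j\ge-1}2^{j\beta_\ell}\big|\langle\Theta^\ell_x,P_j(x-\cdot)\rangle\big|<\infty,\qquad |c^\ell_{yx}|\le C_\ell\,|y-x|^{\gamma-\beta_\ell}\ \text{ for some }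 C_\ell<\infty \text{ and all } x,y\in\mathbb R^d .$$ Then the integrals defining $\mathbf Q_j\Lambda$ converge, the series $\mathbf P(\Lambda)$ converges in $\mathcal S'(\mathbb R^d)$, and: * If $\gamma>0$, there is a unique $f_\Lambda\in\mathcal C^\gamma(\mathbb R^d)$ for which there is a constant $C$ with $$\big|\big\langle\mathbf P(\Lambda)-f_\Lambda-\Lambda_x,\,P_i(x-\cdot)\big\rangle\big|\le C\,2^{-i\gamma}\qquad\text{for all }x\in\mathbb R^d,\ i\ge-1 .$$ It is a bounded continuous function, and it is real-valued if all the $\Lambda_x$ are real-valued distributions. * If $\gamma<0$, there is a constant $C$ with $$\big|\big\langle\mathbf P(\Lambda)-\Lambda_x,\,P_i(x-\cdot)\big\rangle\big|\le C\,2^{-i\gamma}\qquad\text{for all }x\in\mathbb R^d,\ i\ge-1 .$$ -/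

import Mathlib

open MeasureTheory Set
open scoped SchwartzMap FourierTransform ContDiff ENNReal BoundedContinuousFunction

noncomputable section

/-- A dyadic partition of unity of `ℝ^d`: `low` is `ρ₋₁` and `ring` is `ρ₀`; the other members
`ρ_i = ρ₀(2^{-i} ·)`, `i ≥ 1`, are obtained from `ring`, see `DyadicPartition.rho`. -/
structure DyadicPartition (d : ℕ) where
  low : EuclideanSpace ℝ (Fin d) → ℝ
  ring : EuclideanSpace ℝ (Fin d) → ℝ
  low_smooth : ContDiff ℝ ∞ low
  ring_smooth : ContDiff ℝ ∞ ring
  low_radial : ∀ x y, ‖x‖ = ‖y‖ → low x = low y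
  ring_radial : ∀ x y, ‖x‖ = ‖y‖ → ring x = ring y
  low_mem : ∀ x, low x ∈ Icc (0 : ℝ) 1
  ring_mem : ∀ x, ring x ∈ Icc (0 : ℝ) 1
  low_supp : tsupport low ⊆ {x | ‖x‖ < 4 / 3}
  ring_supp : tsupport ring ⊆ {x | 3 / 4 < ‖x‖ ∧ ‖x‖ < 8 / 3}
  sum_eq_one : ∀ x, HasSum (fun i : ℕ => ring (((2 : ℝ) ^ i)⁻¹ • x)) (1 - low x)

/-- The tempered distribution `φ ↦ ∫ φ f` of a bounded continuous function `f`. -/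
def boundedDistribution {d : ℕ} (f : EuclideanSpace ℝ (Fin d) →ᵇ ℂ) :
    𝓢'(EuclideanSpace ℝ (Fin d), ℂ) :=
  Lp.toTemperedDistribution (p := ∞) (μ := volume)
    ((memLp_top_of_bound f.continuous.aestronglyMeasurable ‖f‖
      (Filter.Eventually.of_forall f.norm_coe_le_norm)).toLp f)

/-- The `L^∞` norm of a tempered distribution; it is `∞` if the distribution is not given by a
function in `L^∞`. -/
def linftyNorm {d : ℕ} (T : 𝓢'(EuclideanSpace ℝ (Fin d), ℂ)) : ℝ≥0∞ :=
  ⨅ (u : Lp ℂ ∞ (volume : Measure (EuclideanSpace ℝ (Fin d))))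
    (_ : Lp.toTemperedDistribution u = T), ‖u‖ₑ

/-- A real-valued distribution: it takes real values on real-valued test functions. -/
def IsRealDistribution {d : ℕ} (T : 𝓢'(EuclideanSpace ℝ (Fin d), ℂ)) : Prop :=
  ∀ φ : 𝓢(EuclideanSpace ℝ (Fin d), ℂ), (∀ y, (φ y).im = 0) → (T φ).im = 0

/-- The test function `φ(x - ·)`. -/
def reflectAt {d : ℕ} (φ : 𝓢(EuclideanSpace ℝ (Fin d), ℂ)) (x : EuclideanSpace ℝ (Fin d)) :
    𝓢(EuclideanSpace ℝ (Fin d), ℂ) :=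
  SchwartzMap.compSubConstCLM ℂ x
    (SchwartzMap.compCLMOfContinuousLinearEquiv ℂ
      (ContinuousLinearEquiv.neg ℝ (M := EuclideanSpace ℝ (Fin d))) φ)

theorem reflectAt_apply {d : ℕ} (φ : 𝓢(EuclideanSpace ℝ (Fin d), ℂ))
    (x y : EuclideanSpace ℝ (Fin d)) : reflectAt φ x y = φ (x - y) := by
  simp [reflectAt]

namespace DyadicPartition

variable {d : ℕ} (ρ : DyadicPartition d)

/-- The function `ρ_i`, for `i ≥ -1`; by convention it is `0` for `i < -1`. -/
def rho (i : ℤ) (x : EuclideanSpace ℝ (Fin d)) : ℝ :=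
  if i = -1 then ρ.low x else if 0 ≤ i then ρ.ring (((2 : ℝ) ^ i)⁻¹ • x) else 0

theorem low_hasCompactSupport : HasCompactSupport ρ.low :=
  HasCompactSupport.of_support_subset_isCompact
    (isCompact_closedBall (0 : EuclideanSpace ℝ (Fin d)) (4 / 3))
    fun x hx => by
      have h := ρ.low_supp (subset_tsupport _ hx)
      simpa using (le_of_lt h)

theorem ring_hasCompactSupport : HasCompactSupport ρ.ring :=
  HasCompactSupport.of_support_subset_isCompact
    (isCompact_closedBall (0 : EuclideanSpace ℝ (Fin d)) (8 / 3))
    fun x hx => by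
      have h := (ρ.ring_supp (subset_tsupport _ hx)).2
      simpa using (le_of_lt h)

theorem rho_hasCompactSupport (i : ℤ) : HasCompactSupport fun x => (ρ.rho i x : ℂ) := by
  have h : HasCompactSupport (ρ.rho i) := by
    unfold rho
    by_cases h1 : i = -1
    · simpa [h1] using ρ.low_hasCompactSupport
    · by_cases h2 : 0 ≤ i
      · simp only [h1, h2, if_true, if_false]
        exact ρ.ring_hasCompactSupport.comp_smul (by positivity)
      · simp only [h1, h2, if_false]
        exact HasCompactSupport.zero
  exact h.comp_left (g := fun t : ℝ => (t : ℂ)) (by simp)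

theorem rho_contDiff (i : ℤ) : ContDiff ℝ ∞ fun x => (ρ.rho i x : ℂ) := by
  have h : ContDiff ℝ ∞ (ρ.rho i) := by
    unfold rho
    by_cases h1 : i = -1
    · simpa [h1] using ρ.low_smooth
    · by_cases h2 : 0 ≤ i
      · simp only [h1, h2, if_true, if_false]
        exact ρ.ring_smooth.comp (contDiff_const_smul _)
      · simpa [h1, h2] using contDiff_const
  exact Complex.ofRealCLM.contDiff.comp h

/-- The kernel `Q_i = 𝓕⁻¹ ρ_i` of the Littlewood-Paley block `Δ_i`. -/
def kerQ (i : ℤ) : 𝓢(EuclideanSpace ℝ (Fin d), ℂ) :=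
  𝓕⁻ ((ρ.rho_hasCompactSupport i).toSchwartzMap (ρ.rho_contDiff i))

/-- The kernel `P_j = ∑_{-1 ≤ i ≤ j - 2} Q_i`; in particular `P_j = 0` for `j ≤ 0`. -/
def kerP (j : ℤ) : 𝓢(EuclideanSpace ℝ (Fin d), ℂ) :=
  ∑ i ∈ Finset.Icc (-1) (j - 2), ρ.kerQ i

/-- The Littlewood-Paley block `Δ_i f = 𝓕⁻¹ (ρ_i 𝓕 f)`. -/
def block (i : ℤ) (f : 𝓢'(EuclideanSpace ℝ (Fin d), ℂ)) : 𝓢'(EuclideanSpace ℝ (Fin d), ℂ) :=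
  TemperedDistribution.fourierMultiplierCLM ℂ (fun x => (ρ.rho i x : ℂ)) f

/-- The Hölder-Besov norm `sup_{i ≥ -1} 2^{α i} ‖Δ_i f‖_{L^∞}`. -/
def holderNorm (α : ℝ) (f : 𝓢'(EuclideanSpace ℝ (Fin d), ℂ)) : ℝ≥0∞ :=
  ⨆ (i : ℤ) (_ : -1 ≤ i), ENNReal.ofReal ((2 : ℝ) ^ (α * i)) * linftyNorm (ρ.block i f)

/-- `f ∈ C^α(ℝ^d) = B^α_{∞,∞}(ℝ^d)`. -/
def MemHolder (α : ℝ) (f : 𝓢'(EuclideanSpace ℝ (Fin d), ℂ)) : Prop :=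
  ρ.holderNorm α f < ⊤

/-- `(𝐐_j Λ)(x) = ∬ P_j(x - y) Q_j(x - z) Λ_y(z) dy dz`, the integral in `z` being the pairing
of `Λ_y` with `Q_j(x - ·)`. -/
def bigQ (Λ : EuclideanSpace ℝ (Fin d) → 𝓢'(EuclideanSpace ℝ (Fin d), ℂ)) (j : ℤ)
    (x : EuclideanSpace ℝ (Fin d)) : ℂ :=
  ∫ y, ρ.kerP j (x - y) * Λ y (reflectAt (ρ.kerQ j) x)

/-- `T` is the two-parameter paraproduct `𝐏(Λ) = ∑_{j ≥ 1} 𝐐_j Λ`: all the integrals converge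
and the series converges to `T` in the sense of tempered distributions. -/
structure IsParaproduct (Λ : EuclideanSpace ℝ (Fin d) → 𝓢'(EuclideanSpace ℝ (Fin d), ℂ))
    (T : 𝓢'(EuclideanSpace ℝ (Fin d), ℂ)) : Prop where
  integrable_kernel : ∀ j : ℤ, 1 ≤ j → ∀ x,
    Integrable fun y => ρ.kerP j (x - y) * Λ y (reflectAt (ρ.kerQ j) x)
  integrable_test : ∀ j : ℤ, 1 ≤ j → ∀ φ : 𝓢(EuclideanSpace ℝ (Fin d), ℂ),
    Integrable fun x => φ x * ρ.bigQ Λ j x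
  hasSum : ∀ φ : 𝓢(EuclideanSpace ℝ (Fin d), ℂ),
    HasSum (fun n : ℕ => ∫ x, φ x * ρ.bigQ Λ (n + 1) x) (T φ)

/-- The bound `|⟨T - Λ_x, P_i(x - ·)⟩| ≲ 2^{-iγ}`, uniformly in `x` and in `i ≥ -1`. -/
def Reconstructs (γ : ℝ) (Λ : EuclideanSpace ℝ (Fin d) → 𝓢'(EuclideanSpace ℝ (Fin d), ℂ))
    (T : 𝓢'(EuclideanSpace ℝ (Fin d), ℂ)) : Prop :=
  ∃ C : ℝ, ∀ x : EuclideanSpace ℝ (Fin d), ∀ i : ℤ, -1 ≤ i →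
    ‖(T - Λ x) (reflectAt (ρ.kerP i) x)‖ ≤ C * (2 : ℝ) ^ (-(i : ℝ) * γ)

end DyadicPartition

end

/-! Everything rests on frequency supports. P_j lives in |ξ| < (2/3)2^j and Q_j, for j ≥ 0, in
(3/4)2^j < |ξ| < (8/3)2^j, so 𝐐_jΛ has its spectrum in the annulus between 2^j/12 and (10/3)2^j
(`integral_mul_bigQ_eq_zero`). Together with |𝐐_jΛ| ≲ 2^{-jβ₀} this makes the series converge
whatever β₀ is: on an annulus a high power of |ξ|² can be divided out, and what remains is summable
in L^∞ (`exists_isParaproduct`).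

The main estimate compares 𝐐_jΛ with Δ_jΛ_x. Since ∫P_j = 1, their difference at z is the average of
(Λ_y - Λ_x)(Q_j(z - ·)) against P_j(z - y). Writing Λ_y - Λ_x = (Λ_y - Λ_z) - (Λ_x - Λ_z) bases both
increments at z, where the Θ^ℓ_z are controlled, and bounds the difference by the sum over ℓ of
2^{-jγ} + |x-z|^{a_ℓ} 2^{-j(γ-a_ℓ)}, with a_ℓ = γ - β_ℓ > 0 (`exists_norm_bigQ_sub_le`). Integrated
against a kernel of scale 2^{-i} centred at x, the factor |x-z| becomes 2^{-i}.

If γ < 0, P_i(x - ·) sees only the indices j ≤ i+2, and the resulting geometric sums are dominated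
by their last terms (`reconstructs_of_neg`).

If γ > 0, those sums no longer decay in i, but Q_k(x - ·) sees only boundedly many j near k, so
⟨𝐏(Λ) - Λ_x, Q_k(x - ·)⟩ = O(2^{-kγ}). Hence ⟨𝐏(Λ) - Λ_x, P_n(x - ·)⟩ converges geometrically and
uniformly to a function f(x) (`exists_limit`). This f lies in C^γ because P_k and Q_k have disjoint
spectra (`exists_norm_convAt_kerQ_le`); then P_n * f - f = O(2^{-nγ}), and f is the required
correction. Two corrections differ by a distribution whose low-frequency truncations tend uniformly
to 0, hence by 0 (`eq_zero_of_tendsto`). -/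

noncomputable section


/-! ### Fourier multipliers, convolutions and dilations on Schwartz functions -/

section Multiplier

variable {d : ℕ}

local notation "𝔼" => EuclideanSpace ℝ (Fin d)

/-- The transpose `φ ↦ 𝓕 (g 𝓕⁻¹ φ)` of the Fourier multiplier with symbol `g`. -/
def dualMult (g : 𝔼 → ℂ) : 𝓢(𝔼, ℂ) →L[ℂ] 𝓢(𝔼, ℂ) :=
  FourierTransform.fourierCLM ℂ 𝓢(𝔼, ℂ) ∘L SchwartzMap.smulLeftCLM ℂ g ∘L
    FourierTransform.fourierInvCLM ℂ 𝓢(𝔼, ℂ)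

theorem fourierMultiplierCLM_apply_eq_dualMult (g : 𝔼 → ℂ) (T : 𝓢'(𝔼, ℂ)) (φ : 𝓢(𝔼, ℂ)) :
    TemperedDistribution.fourierMultiplierCLM ℂ g T φ = T (dualMult g φ) := rfl

theorem fourierInv_dualMult {g : 𝔼 → ℂ} (hg : g.HasTemperateGrowth) (φ : 𝓢(𝔼, ℂ)) (ξ : 𝔼) :
    𝓕⁻ (dualMult g φ) ξ = g ξ * 𝓕⁻ φ ξ := by
  simp [dualMult, hg]

theorem schwartz_ext_fourierInv {φ ψ : 𝓢(𝔼, ℂ)} (h : ∀ ξ, 𝓕⁻ φ ξ = 𝓕⁻ ψ ξ) : φ = ψ := by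
  have h' : 𝓕⁻ φ = 𝓕⁻ ψ := SchwartzMap.ext h
  have := congrArg (fun f : 𝓢(𝔼, ℂ) => 𝓕 f) h'
  simpa using this

theorem fourierInv_reflectAt (K : 𝓢(𝔼, ℂ)) (x ξ : 𝔼) :
    𝓕⁻ (reflectAt K x) ξ = (Real.fourierChar (inner ℝ x ξ) : ℂ) * 𝓕 K ξ := by
  rw [SchwartzMap.fourierInv_coe, SchwartzMap.fourier_coe, Real.fourierInv_eq, Real.fourier_eq]
  rw [← integral_sub_left_eq_self _ volume x, ← integral_const_mul]
  refine integral_congr_ae (Filter.Eventually.of_forall fun v => ?_)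
  simp only [reflectAt_apply, sub_sub_cancel, Circle.smul_def, smul_eq_mul, inner_sub_left]
  rw [sub_eq_add_neg, AddChar.map_add_eq_mul, Circle.coe_mul]
  ring

theorem fourierInv_reflectAt_fourierInv (g : 𝓢(𝔼, ℂ)) (x ξ : 𝔼) :
    𝓕⁻ (reflectAt (𝓕⁻ g) x) ξ = (Real.fourierChar (inner ℝ x ξ) : ℂ) * g ξ := by
  rw [fourierInv_reflectAt]; simp

theorem dualMult_reflectAt {g : 𝔼 → ℂ} (hg : g.HasTemperateGrowth) {a b : 𝓢(𝔼, ℂ)}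
    (h : ∀ ξ, g ξ * a ξ = b ξ) (x : 𝔼) :
    dualMult g (reflectAt (𝓕⁻ a) x) = reflectAt (𝓕⁻ b) x := by
  refine schwartz_ext_fourierInv fun ξ => ?_
  rw [fourierInv_dualMult hg, fourierInv_reflectAt_fourierInv, fourierInv_reflectAt_fourierInv, ← h]
  ring

theorem dualMult_dualMult {g₁ g₂ g₃ : 𝔼 → ℂ} (h₁ : g₁.HasTemperateGrowth)
    (h₂ : g₂.HasTemperateGrowth) (h₃ : g₃.HasTemperateGrowth) (h : ∀ ξ, g₁ ξ * g₂ ξ = g₃ ξ)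
    (φ : 𝓢(𝔼, ℂ)) :
    dualMult g₁ (dualMult g₂ φ) = dualMult g₃ φ := by
  refine schwartz_ext_fourierInv fun ξ => ?_
  rw [fourierInv_dualMult h₁, fourierInv_dualMult h₂, fourierInv_dualMult h₃, ← h]
  ring

theorem fourier_compSubConst_fourierInv (g : 𝓢(𝔼, ℂ)) (w ξ : 𝔼) :
    𝓕 (SchwartzMap.compSubConstCLM ℂ w (𝓕⁻ g)) ξ =
      (Real.fourierChar (-inner ℝ ξ w) : ℂ) * g ξ := by
  have h2 : g ξ = 𝓕 (𝓕⁻ g) ξ := by simp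
  rw [h2, SchwartzMap.fourier_coe, SchwartzMap.fourier_coe, Real.fourier_eq, Real.fourier_eq,
    ← integral_add_right_eq_self _ w, ← integral_const_mul]
  refine integral_congr_ae (Filter.Eventually.of_forall fun v => ?_)
  simp only [SchwartzMap.compSubConstCLM_apply, add_sub_cancel_right, Circle.smul_def,
    smul_eq_mul, inner_add_left, neg_add, AddChar.map_add_eq_mul, Circle.coe_mul,
    real_inner_comm w ξ]
  ring

theorem dualMult_apply (g φ : 𝓢(𝔼, ℂ)) (w : 𝔼) :
    dualMult g φ w = ∫ z, φ z * 𝓕⁻ g (z - w) := by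
  have h3 := SchwartzMap.integral_fourierInv_mul_eq φ
    (𝓕 (SchwartzMap.compSubConstCLM ℂ w (𝓕⁻ g)))
  simp only [FourierTransform.fourierInv_fourier_eq, SchwartzMap.compSubConstCLM_apply] at h3
  rw [← h3]
  change 𝓕 (SchwartzMap.smulLeftCLM ℂ g (𝓕⁻ φ)) w = _
  rw [SchwartzMap.fourier_coe, Real.fourier_eq]
  refine integral_congr_ae (Filter.Eventually.of_forall fun v => ?_)
  simp only [fourier_compSubConst_fourierInv, SchwartzMap.smulLeftCLM_apply_apply g.hasTemperateGrowth, Circle.smul_def,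
    smul_eq_mul]
  ring

/-- The convolution `z ↦ ∫ K (z - w) v w dw`. -/
def convAt (K v : 𝔼 → ℂ) (z : 𝔼) : ℂ := ∫ w, K (z - w) * v w

theorem integrable_mul_of_bound {K v : 𝔼 → ℂ} (hK : Integrable K) (hv : AEStronglyMeasurable v)
    {C : ℝ} (hC : ∀ x, ‖v x‖ ≤ C) : Integrable fun w => K w * v w :=
  hK.mul_bdd hv (Filter.Eventually.of_forall hC)

theorem norm_integral_mul_le {K v : 𝔼 → ℂ} (hK : Integrable K)
    {C : ℝ} (hC : ∀ x, ‖v x‖ ≤ C) : ‖∫ w, K w * v w‖ ≤ (∫ w, ‖K w‖) * C := by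
  rw [← integral_mul_const]
  refine norm_integral_le_of_norm_le (hK.norm.mul_const C)
    (Filter.Eventually.of_forall fun w => ?_)
  rw [norm_mul]
  gcongr
  exact hC w

theorem norm_convAt_le {K v : 𝔼 → ℂ} (hK : Integrable K)
    {C : ℝ} (hC : ∀ x, ‖v x‖ ≤ C) (z : 𝔼) : ‖convAt K v z‖ ≤ (∫ w, ‖K w‖) * C := by
  rw [← integral_sub_left_eq_self (fun w => ‖K w‖) volume z]
  exact norm_integral_mul_le (hK.comp_sub_left z) hC

/-- As `v` is only measurable and bounded, continuity comes from `K`: for |z - z₀| ≤ 1 one has 1 +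
|z₀ - w| ≤ 2(1 + |z - w|), so the decay of `K` gives one integrable majorant for all z near z₀. -/
theorem continuous_convAt {K : 𝓢(𝔼, ℂ)} {v : 𝔼 → ℂ} (hv : AEStronglyMeasurable v)
    {C : ℝ} (hC : ∀ x, ‖v x‖ ≤ C) : Continuous (convAt K v) := by
  refine continuous_iff_continuousAt.2 fun z₀ => ?_
  obtain ⟨n, hn⟩ : ∃ n : ℕ, (Module.finrank ℝ 𝔼 : ℝ) < n := exists_nat_gt _
  set M := 2 ^ n * ((Finset.Iic (n, 0)).sup fun m => SchwartzMap.seminorm ℝ m.1 m.2) K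
  have hM : ∀ y, (1 + ‖y‖) ^ n * ‖K y‖ ≤ M := fun y => by
    have := SchwartzMap.one_add_le_sup_seminorm_apply (𝕜 := ℝ) (m := (n, 0)) (k := n) (n := 0)
      le_rfl le_rfl K y
    simpa using this
  have hint : Integrable (fun w : 𝔼 => (1 + ‖z₀ - w‖) ^ (-(n : ℝ))) :=
    (integrable_one_add_norm hn).comp_sub_left z₀
  have hC0 : 0 ≤ C := (norm_nonneg _).trans (hC 0)
  refine continuousAt_of_dominated (bound := fun w => 2 ^ n * M * C * (1 + ‖z₀ - w‖) ^ (-(n : ℝ)))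
    (Filter.Eventually.of_forall fun z => ?_) ?_ (hint.const_mul _)
    (Filter.Eventually.of_forall fun w => ?_)
  · exact ((K.continuous.comp (continuous_const.sub continuous_id)).aestronglyMeasurable).mul hv
  · filter_upwards [Metric.closedBall_mem_nhds z₀ one_pos] with z hz
    refine Filter.Eventually.of_forall fun w => ?_
    rw [Metric.mem_closedBall, dist_eq_norm] at hz
    have h1 : 1 + ‖z₀ - w‖ ≤ 2 * (1 + ‖z - w‖) := by
      have : ‖z₀ - w‖ ≤ ‖z - w‖ + ‖z - z₀‖ := by
        have := norm_sub_le (z - w) (z - z₀)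
        rwa [show z - w - (z - z₀) = z₀ - w by abel] at this
      linarith [norm_nonneg (z - w)]
    have h2 : (1 + ‖z₀ - w‖) ^ n ≤ 2 ^ n * (1 + ‖z - w‖) ^ n := by
      rw [← mul_pow]; gcongr
    have hpos : 0 < (1 + ‖z₀ - w‖) ^ n := by positivity
    have h3 : (1 + ‖z₀ - w‖) ^ n * ‖K (z - w)‖ ≤ 2 ^ n * M := by
      calc _ ≤ 2 ^ n * (1 + ‖z - w‖) ^ n * ‖K (z - w)‖ := by gcongr
        _ = 2 ^ n * ((1 + ‖z - w‖) ^ n * ‖K (z - w)‖) := by ring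
        _ ≤ _ := by gcongr; exact hM _
    rw [norm_mul, Real.rpow_neg (by positivity), Real.rpow_natCast, ← div_eq_mul_inv,
      le_div_iff₀ hpos]
    calc ‖K (z - w)‖ * ‖v w‖ * (1 + ‖z₀ - w‖) ^ n
        = ((1 + ‖z₀ - w‖) ^ n * ‖K (z - w)‖) * ‖v w‖ := by ring
      _ ≤ 2 ^ n * M * C := by
        have := hC w
        gcongr
  · exact ((K.continuous.comp (continuous_id.sub continuous_const)).mul
      continuous_const).continuousAt

theorem integrable_prod_mul_sub {φ K : 𝔼 → ℂ} (hφ : Integrable φ) (hK : Integrable K) :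
    Integrable (fun p : 𝔼 × 𝔼 => φ p.1 * K (p.1 - p.2)) (volume.prod volume) := by
  simpa [Function.comp_def] using
    (hφ.convolution_integrand (ContinuousLinearMap.mul ℂ ℂ) hK.comp_neg).swap

theorem integral_dualMult_mul (g φ : 𝓢(𝔼, ℂ)) {v : 𝔼 → ℂ} (hv : AEStronglyMeasurable v)
    {C : ℝ} (hC : ∀ x, ‖v x‖ ≤ C) :
    ∫ w, dualMult g φ w * v w = ∫ z, φ z * convAt (𝓕⁻ g : 𝓢(𝔼, ℂ)) v z := by
  simp only [dualMult_apply, convAt, ← integral_mul_const, ← integral_const_mul]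
  rw [integral_integral_swap]
  · simp only [mul_assoc]
  · exact (integrable_prod_mul_sub φ.integrable (𝓕⁻ g).integrable).swap.mul_bdd hv.comp_fst
      (Filter.Eventually.of_forall fun p => hC p.1)


/-- The spectrum of a product lies in the sum of the spectra: by Parseval the left side is an
integral over η of a phase times p(η) 𝓕⁻φ(ξ + η), and the hypothesis kills the integrand. -/
theorem fourierInv_mul_translate_eq_zero (p φ : 𝓢(𝔼, ℂ)) (y ξ : 𝔼)
    (h : ∀ η, p η ≠ 0 → 𝓕⁻ φ (ξ + η) = 0) :
    𝓕⁻ (SchwartzMap.smulLeftCLM ℂ (SchwartzMap.compSubConstCLM ℂ y (𝓕⁻ p)) φ) ξ = 0 := by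
  have h3 := SchwartzMap.integral_fourierInv_mul_eq
    (𝓕 (SchwartzMap.compSubConstCLM ℂ y (𝓕⁻ p)))
    (𝓕 (SchwartzMap.compSubConstCLM ℂ (-ξ) (𝓕⁻ φ)))
  simp only [FourierTransform.fourierInv_fourier_eq, fourier_compSubConst_fourierInv,
    SchwartzMap.compSubConstCLM_apply, inner_neg_right, neg_neg, sub_neg_eq_add] at h3
  rw [SchwartzMap.fourierInv_coe, Real.fourierInv_eq]
  refine Eq.trans ?_ (h3.trans ?_)
  · refine integral_congr_ae (Filter.Eventually.of_forall fun v => ?_)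
    simp only [SchwartzMap.smulLeftCLM_apply_apply (SchwartzMap.hasTemperateGrowth _),
      SchwartzMap.compSubConstCLM_apply, Circle.smul_def, smul_eq_mul]
    ring
  · refine integral_eq_zero_of_ae (Filter.Eventually.of_forall fun η => ?_)
    by_cases hη : p η = 0
    · simp [hη]
    · simp [add_comm η ξ, h η hη]

theorem fourierInv_dilate {g g' : 𝓢(𝔼, ℂ)} {r : ℝ} (hr : 0 < r) (h : ∀ ξ, g' ξ = g (r⁻¹ • ξ))
    (x : 𝔼) : 𝓕⁻ g' x = (r : ℂ) ^ d * 𝓕⁻ g (r • x) := by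
  rw [SchwartzMap.fourierInv_coe, SchwartzMap.fourierInv_coe, Real.fourierInv_eq,
    Real.fourierInv_eq]
  have := Measure.integral_comp_inv_smul_of_nonneg (volume : Measure 𝔼)
    (fun v : 𝔼 => Real.fourierChar (inner ℝ v (r • x)) • g v) hr.le
  simp only [finrank_euclideanSpace, Fintype.card_fin] at this
  rw [Complex.real_smul] at this
  push_cast at this
  rw [← this]
  refine integral_congr_ae (Filter.Eventually.of_forall fun v => ?_)
  simp only [h, real_inner_smul_left, real_inner_smul_right]
  rw [mul_inv_cancel_left₀ hr.ne']

theorem integrable_norm_mul_norm_rpow (K : 𝓢(𝔼, ℂ)) {a : ℝ} (ha : 0 ≤ a) :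
    Integrable fun x => ‖K x‖ * ‖x‖ ^ a := by
  obtain ⟨n, hn⟩ := exists_nat_ge a
  have h1 := K.integrable.norm.add (K.integrable_pow_mul volume n)
  refine h1.mono' ?_ (Filter.Eventually.of_forall fun x => ?_)
  · exact (K.continuous.norm.mul (continuous_norm.rpow_const fun _ => .inr ha)).aestronglyMeasurable
  · have h2 : ‖x‖ ^ a ≤ 1 + ‖x‖ ^ n := by
      rcases le_total ‖x‖ 1 with h | h
      · have := Real.rpow_le_one (norm_nonneg x) h ha
        have : 0 ≤ ‖x‖ ^ n := by positivity
        linarith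
      · have := Real.rpow_le_rpow_of_exponent_le h hn
        rw [Real.rpow_natCast] at this
        linarith
    rw [Real.norm_of_nonneg (by positivity)]
    simp only [Pi.add_apply]
    nlinarith [norm_nonneg (K x)]

theorem integral_norm_mul_rpow_dilate {g g' : 𝓢(𝔼, ℂ)} {r : ℝ} (hr : 0 < r)
    (h : ∀ ξ, g' ξ = g (r⁻¹ • ξ)) (a : ℝ) :
    ∫ x, ‖𝓕⁻ g' x‖ * ‖x‖ ^ a = r ^ (-a) * ∫ x, ‖𝓕⁻ g x‖ * ‖x‖ ^ a := by
  have := Measure.integral_comp_smul_of_nonneg (volume : Measure 𝔼)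
    (fun x : 𝔼 => ‖𝓕⁻ g x‖ * ‖x‖ ^ a) r (hR := hr.le)
  simp only [finrank_euclideanSpace, Fintype.card_fin, smul_eq_mul] at this
  have h2 : ∫ x, ‖𝓕⁻ g x‖ * ‖x‖ ^ a =
      r ^ d * ∫ x : 𝔼, ‖𝓕⁻ g (r • x)‖ * ‖r • x‖ ^ a := by
    rw [this, mul_inv_cancel_left₀ (by positivity)]
  rw [h2, ← integral_const_mul, ← integral_const_mul]
  refine integral_congr_ae (Filter.Eventually.of_forall fun x => ?_)
  simp only [fourierInv_dilate hr h, norm_mul, norm_pow, norm_smul, Complex.norm_real,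
    Real.norm_of_nonneg hr.le, Real.mul_rpow hr.le (norm_nonneg x), Real.rpow_neg hr.le]
  field_simp

/-- The function χ(2^{-N}·) - 1 vanishes on |ξ| < r 2^N and has derivatives bounded uniformly in N.
Outside that ball one extra power of |x|, absorbed by a higher seminorm of φ, gains the factor 1/(r
2^N). -/
theorem tendsto_smulLeftCLM_dilate {χ : 𝓢(𝔼, ℂ)} {χs : ℕ → 𝓢(𝔼, ℂ)} {r : ℝ} (hr : 0 < r)
    (hχ : ∀ ξ, ‖ξ‖ ≤ r → χ ξ = 1) (hχs : ∀ n ξ, χs n ξ = χ (((2 : ℝ) ^ n)⁻¹ • ξ))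
    (φ : 𝓢(𝔼, ℂ)) :
    Filter.Tendsto (fun n => SchwartzMap.smulLeftCLM ℂ (χs n) φ) Filter.atTop (nhds φ) := by
  rw [(schwartz_withSeminorms ℝ 𝔼 ℂ).tendsto_nhds]
  rintro ⟨k, n⟩ ε hε
  simp only [SchwartzMap.schwartzSeminormFamily_apply]
  set A : ℝ := ∑ i ∈ Finset.range (n + 1), (n.choose i : ℝ) *
    (SchwartzMap.seminorm ℝ 0 i χ + 1) * SchwartzMap.seminorm ℝ (k + 1) (n - i) φ
  have hA : 0 ≤ A := Finset.sum_nonneg fun i _ => by positivity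
  have hmain : ∀ N : ℕ, SchwartzMap.seminorm ℝ k n (SchwartzMap.smulLeftCLM ℂ (χs N) φ - φ) ≤
      A / r * (1 / 2) ^ N := by
    intro N
    refine SchwartzMap.seminorm_le_bound ℝ k n _ (by positivity) fun x => ?_
    set m : 𝔼 → ℂ := fun ξ => χ (((2 : ℝ) ^ N)⁻¹ • ξ) - 1
    have hfun : ⇑(SchwartzMap.smulLeftCLM ℂ (χs N) φ - φ) = fun ξ => m ξ * φ ξ := by
      funext ξ
      simp [SchwartzMap.smulLeftCLM_apply_apply (SchwartzMap.hasTemperateGrowth _), hχs, m, sub_mul]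
    rw [hfun]
    rcases lt_or_ge ‖x‖ (r * 2 ^ N) with hx | hx
    · have : (fun ξ => m ξ * φ ξ) =ᶠ[nhds x] fun _ => 0 := by
        filter_upwards [(continuous_norm.tendsto x).eventually (gt_mem_nhds hx)] with ξ hξ
        have : ‖((2 : ℝ) ^ N)⁻¹ • ξ‖ ≤ r := by
          rw [norm_smul, norm_inv, norm_pow, Real.norm_two, inv_mul_le_iff₀ (by positivity)]
          linarith
        simp [m, hχ _ this]
      rw [(Filter.EventuallyEq.iteratedFDeriv ℝ this n).eq_of_nhds]
      simp
      positivity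
    · have hx0 : 0 < ‖x‖ := lt_of_lt_of_le (by positivity) hx
      have hm : ContDiff ℝ ∞ m := by
        exact ((χ.smooth ⊤).comp (contDiff_const_smul _)).sub contDiff_const
      have hmb : ∀ i : ℕ, ‖iteratedFDeriv ℝ i m x‖ ≤ SchwartzMap.seminorm ℝ 0 i χ + 1 := by
        intro i
        have e1 := iteratedFDeriv_comp_const_smul (i := i) (f := χ) ((2 : ℝ) ^ N)⁻¹ (χ.smooth i)
        have e2 : iteratedFDeriv ℝ i m x = iteratedFDeriv ℝ i (fun ξ => χ (((2 : ℝ) ^ N)⁻¹ • ξ)) x -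
            iteratedFDeriv ℝ i (fun _ : 𝔼 => (1 : ℂ)) x :=
          fun_iteratedFDeriv_sub_apply
            ((χ.smooth i).comp (contDiff_const_smul _)).contDiffAt contDiff_const.contDiffAt
        rw [e2, e1]
        refine (norm_sub_le _ _).trans (add_le_add ?_ ?_)
        · have h4 := SchwartzMap.norm_iteratedFDeriv_le_seminorm ℝ χ i (((2 : ℝ) ^ N)⁻¹ • x)
          have h5 : (((2 : ℝ) ^ N)⁻¹) ^ i ≤ 1 :=
            pow_le_one₀ (by positivity) (inv_le_one_of_one_le₀ (one_le_pow₀ one_le_two))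
          rw [norm_smul, Real.norm_of_nonneg (by positivity)]
          exact (mul_le_mul h5 h4 (norm_nonneg _) zero_le_one).trans_eq (one_mul _)
        · rcases Nat.eq_zero_or_pos i with rfl | hi
          · simp
          · rw [iteratedFDeriv_const_of_ne hi.ne']; simp
      have h1 := norm_iteratedFDeriv_mul_le hm (φ.smooth ⊤) x (n := n) (by exact_mod_cast le_top)
      calc ‖x‖ ^ k * ‖iteratedFDeriv ℝ n (fun ξ => m ξ * φ ξ) x‖
          ≤ ‖x‖ ^ k * ∑ i ∈ Finset.range (n + 1), (n.choose i : ℝ) * ‖iteratedFDeriv ℝ i m x‖ *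
            ‖iteratedFDeriv ℝ (n - i) φ x‖ := by gcongr
        _ ≤ ‖x‖⁻¹ * A := by
          rw [Finset.mul_sum, Finset.mul_sum]
          refine Finset.sum_le_sum fun i _ => ?_
          have h2 := SchwartzMap.le_seminorm ℝ (k + 1) (n - i) φ x
          have h3 : ‖x‖ ^ k * ‖iteratedFDeriv ℝ (n - i) φ x‖ ≤
              ‖x‖⁻¹ * SchwartzMap.seminorm ℝ (k + 1) (n - i) φ := by
            rw [le_inv_mul_iff₀ hx0, ← mul_assoc, ← pow_succ']
            exact h2
          calc _ = (n.choose i : ℝ) * ‖iteratedFDeriv ℝ i m x‖ *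
                (‖x‖ ^ k * ‖iteratedFDeriv ℝ (n - i) φ x‖) := by ring
            _ ≤ (n.choose i : ℝ) * (SchwartzMap.seminorm ℝ 0 i χ + 1) *
                (‖x‖⁻¹ * SchwartzMap.seminorm ℝ (k + 1) (n - i) φ) := by
              gcongr
              exact hmb i
            _ = _ := by ring
        _ ≤ (r * 2 ^ N)⁻¹ * A := by gcongr
        _ = A / r * (1 / 2) ^ N := by
          rw [mul_inv, one_div, inv_pow]; ring
  have ht : Filter.Tendsto (fun N : ℕ => A / r * (1 / 2 : ℝ) ^ N) Filter.atTop (nhds 0) := by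
    simpa using (tendsto_pow_atTop_nhds_zero_of_lt_one (r := (1 / 2 : ℝ)) (by norm_num)
      (by norm_num)).const_mul (A / r)
  filter_upwards [ht.eventually (gt_mem_nhds hε)] with N hN
  exact (hmain N).trans_lt hN

end Multiplier


/-! ### Supports, scaling and moments of the kernels P_j and Q_j -/

section Kernels

variable {d : ℕ}

local notation "𝔼" => EuclideanSpace ℝ (Fin d)

theorem im_fourierInv_eq_zero {g : 𝓢(𝔼, ℂ)} (him : ∀ ξ, (g ξ).im = 0) (heven : ∀ ξ, g (-ξ) = g ξ)
    (x : 𝔼) : (𝓕⁻ g x).im = 0 := by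
  rw [← Complex.conj_eq_iff_im, SchwartzMap.fourierInv_coe, Real.fourierInv_eq, ← integral_conj,
    ← integral_neg_eq_self]
  refine integral_congr_ae (Filter.Eventually.of_forall fun v => ?_)
  simp only [Circle.smul_def, smul_eq_mul, map_mul, heven, inner_neg_left,
    Complex.conj_eq_iff_im.2 (him v)]
  rw [AddChar.map_neg_eq_inv, Circle.coe_inv_eq_conj, Complex.conj_conj]

namespace DyadicPartition

variable (ρ : DyadicPartition d)

theorem ring_eq_zero_of_le {ξ : 𝔼} (h : ‖ξ‖ ≤ 3 / 4) : ρ.ring ξ = 0 := by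
  by_contra h0
  exact absurd (ρ.ring_supp (subset_tsupport _ h0)).1 (not_lt.2 h)

theorem ring_eq_zero_of_ge {ξ : 𝔼} (h : 8 / 3 ≤ ‖ξ‖) : ρ.ring ξ = 0 := by
  by_contra h0
  exact absurd (ρ.ring_supp (subset_tsupport _ h0)).2 (not_lt.2 h)

theorem low_eq_zero {ξ : 𝔼} (h : 4 / 3 ≤ ‖ξ‖) : ρ.low ξ = 0 := by
  by_contra h0
  exact absurd (ρ.low_supp (subset_tsupport _ h0)) (not_lt.2 h)

theorem low_eq_one {ξ : 𝔼} (h : ‖ξ‖ ≤ 3 / 4) : ρ.low ξ = 1 := by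
  have h1 := ρ.sum_eq_one ξ
  have h2 : (fun i : ℕ => ρ.ring (((2 : ℝ) ^ i)⁻¹ • ξ)) = fun _ => 0 := by
    funext i
    refine ρ.ring_eq_zero_of_le ?_
    rw [norm_smul, norm_inv, norm_pow, Real.norm_two]
    have : ((2 : ℝ) ^ i)⁻¹ ≤ 1 := inv_le_one_of_one_le₀ (one_le_pow₀ one_le_two)
    nlinarith [norm_nonneg ξ]
  rw [h2] at h1
  linarith [h1.unique hasSum_zero]

/-- The partition identity at ξ/2 is the one at ξ with its first ring removed. Iterated, this
collapses the symbol of P_j to one dilate of ρ₋₁, so that all P_j with j ≥ 1 are rescalings of P_1.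
-/
theorem low_half (ξ : 𝔼) : ρ.low ((2 : ℝ)⁻¹ • ξ) = ρ.low ξ + ρ.ring ξ := by
  have h1 := ρ.sum_eq_one ((2 : ℝ)⁻¹ • ξ)
  have h2 := (hasSum_nat_add_iff' 1).2 (ρ.sum_eq_one ξ)
  have h3 : (fun i : ℕ => ρ.ring (((2 : ℝ) ^ i)⁻¹ • (2 : ℝ)⁻¹ • ξ)) =
      fun i : ℕ => ρ.ring (((2 : ℝ) ^ (i + 1))⁻¹ • ξ) := by
    funext i
    rw [smul_smul, ← mul_inv, ← pow_succ]
  rw [h3] at h1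
  have := h1.unique h2
  simp at this
  linarith

/-- The symbol `ρ_i` of the Littlewood-Paley block, as a Schwartz function. -/
def symQ (i : ℤ) : 𝓢(𝔼, ℂ) := (ρ.rho_hasCompactSupport i).toSchwartzMap (ρ.rho_contDiff i)

/-- The Fourier transform `∑_{-1 ≤ i ≤ j - 2} ρ_i` of the kernel `P_j`. -/
def symP (j : ℤ) : 𝓢(𝔼, ℂ) := ∑ i ∈ Finset.Icc (-1) (j - 2), ρ.symQ i

theorem symQ_apply (i : ℤ) (ξ : 𝔼) : ρ.symQ i ξ = (ρ.rho i ξ : ℂ) := rfl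

theorem coe_symQ (i : ℤ) : ⇑(ρ.symQ i) = fun ξ => (ρ.rho i ξ : ℂ) := rfl

theorem kerQ_eq (i : ℤ) : ρ.kerQ i = 𝓕⁻ (ρ.symQ i) := rfl

theorem kerP_eq (j : ℤ) : ρ.kerP j = 𝓕⁻ (ρ.symP j) := by
  simp [kerP, symP, kerQ_eq]

theorem symP_of_nonpos {j : ℤ} (hj : j ≤ 0) : ρ.symP j = 0 := by
  rw [symP, Finset.Icc_eq_empty (by lia), Finset.sum_empty]

theorem kerP_of_nonpos {j : ℤ} (hj : j ≤ 0) : ρ.kerP j = 0 := by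
  rw [kerP, Finset.Icc_eq_empty (by lia), Finset.sum_empty]

theorem Icc_succ {j : ℤ} (hj : -1 ≤ j) :
    Finset.Icc (-1) (j + 2 - 2) = insert j (Finset.Icc (-1) (j + 1 - 2)) := by
  ext i; simp only [Finset.mem_Icc, Finset.mem_insert]; lia

theorem symP_add_two {j : ℤ} (hj : -1 ≤ j) : ρ.symP (j + 2) = ρ.symP (j + 1) + ρ.symQ j := by
  rw [symP, Icc_succ hj, Finset.sum_insert (by simp; lia), add_comm, symP]

theorem kerP_add_two {j : ℤ} (hj : -1 ≤ j) : ρ.kerP (j + 2) = ρ.kerP (j + 1) + ρ.kerQ j := by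
  rw [kerP, Icc_succ hj, Finset.sum_insert (by simp; lia), add_comm, kerP]

theorem symP_apply {j : ℤ} (hj : 1 ≤ j) (ξ : 𝔼) :
    ρ.symP j ξ = (ρ.low (((2 : ℝ) ^ (j - 1))⁻¹ • ξ) : ℂ) := by
  induction j, hj using Int.leInduction with
  | base => simp [symP, symQ_apply, rho]
  | succ j hj ih =>
    have h1 := ρ.symP_add_two (j := j - 1) (by lia)
    rw [show j - 1 + 2 = j + 1 by ring, show j - 1 + 1 = j by ring] at h1
    have h2 : ρ.symP (j + 1) ξ = ρ.symP j ξ + ρ.symQ (j - 1) ξ := by rw [h1]; rfl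
    have h3 := ρ.low_half (((2 : ℝ) ^ (j - 1))⁻¹ • ξ)
    rw [smul_smul, ← mul_inv, mul_comm (2 : ℝ), ← zpow_add_one₀ two_ne_zero] at h3
    rw [h2, ih, symQ_apply, rho, if_neg (by lia), if_pos (by lia),
      show j + 1 - 1 = j - 1 + 1 by ring, h3]
    push_cast
    rfl

theorem norm_two_zpow_inv_smul (j : ℤ) (ξ : 𝔼) : ‖((2 : ℝ) ^ j)⁻¹ • ξ‖ = ‖ξ‖ / 2 ^ j := by
  rw [norm_smul, norm_inv, norm_zpow, Real.norm_two, inv_mul_eq_div]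

theorem symP_eq_zero (j : ℤ) {ξ : 𝔼} (h : 2 / 3 * 2 ^ j ≤ ‖ξ‖) : ρ.symP j ξ = 0 := by
  rcases le_or_gt j 0 with hj | hj
  · simp [ρ.symP_of_nonpos hj]
  · rw [ρ.symP_apply hj, ρ.low_eq_zero, Complex.ofReal_zero]
    rw [norm_two_zpow_inv_smul, le_div_iff₀ (by positivity), zpow_sub_one₀ two_ne_zero]
    linarith

theorem symP_eq_one {j : ℤ} (hj : 1 ≤ j) {ξ : 𝔼} (h : ‖ξ‖ ≤ 3 / 8 * 2 ^ j) : ρ.symP j ξ = 1 := by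
  rw [ρ.symP_apply hj, ρ.low_eq_one, Complex.ofReal_one]
  rw [norm_two_zpow_inv_smul, div_le_iff₀ (by positivity), zpow_sub_one₀ two_ne_zero]
  linarith

theorem symQ_eq_zero_of_le {j : ℤ} (hj : 0 ≤ j) {ξ : 𝔼} (h : ‖ξ‖ ≤ 3 / 4 * 2 ^ j) :
    ρ.symQ j ξ = 0 := by
  rw [symQ_apply, rho, if_neg (by lia), if_pos hj, ρ.ring_eq_zero_of_le, Complex.ofReal_zero]
  rwa [norm_two_zpow_inv_smul, div_le_iff₀ (by positivity)]

theorem symQ_eq_zero_of_ge (j : ℤ) {ξ : 𝔼} (h : 8 / 3 * 2 ^ j ≤ ‖ξ‖) :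
    ρ.symQ j ξ = 0 := by
  rw [symQ_apply, rho]
  split_ifs with h1 h2
  · rw [ρ.low_eq_zero, Complex.ofReal_zero]
    subst h1
    norm_num at h
    linarith
  · rw [ρ.ring_eq_zero_of_ge, Complex.ofReal_zero]
    rwa [norm_two_zpow_inv_smul, le_div_iff₀ (by positivity)]
  · simp

theorem low_neg (ξ : 𝔼) : ρ.low (-ξ) = ρ.low ξ := ρ.low_radial _ _ (norm_neg ξ)

theorem rho_neg (i : ℤ) (ξ : 𝔼) : ρ.rho i (-ξ) = ρ.rho i ξ := by
  simp only [rho, smul_neg]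
  rw [ρ.low_neg, ρ.ring_radial _ _ (norm_neg _)]

theorem im_kerQ (i : ℤ) (x : 𝔼) : (ρ.kerQ i x).im = 0 :=
  im_fourierInv_eq_zero (g := ρ.symQ i) (fun ξ => by simp [symQ_apply])
    (fun ξ => by simp [symQ_apply, rho_neg]) x

theorem im_kerP (j : ℤ) (x : 𝔼) : (ρ.kerP j x).im = 0 := by
  rw [kerP, sum_apply, Complex.im_sum]
  exact Finset.sum_eq_zero fun i _ => ρ.im_kerQ i x

theorem integral_kerP {j : ℤ} (hj : 1 ≤ j) : ∫ x, ρ.kerP j x = 1 := by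
  have h : 𝓕 (ρ.kerP j) 0 = ρ.symP j 0 := by rw [kerP_eq]; simp
  rw [ρ.symP_eq_one hj (by simp; positivity), SchwartzMap.fourier_coe, Real.fourier_eq] at h
  simpa using h

theorem exists_moment_kerP_le (a : ℝ) : ∃ C : ℝ, 0 ≤ C ∧ ∀ j : ℤ,
    ∫ x, ‖ρ.kerP j x‖ * ‖x‖ ^ a ≤ C * 2 ^ (-(j : ℝ) * a) := by
  set I := ∫ x, ‖ρ.kerP 1 x‖ * ‖x‖ ^ a
  have hI : 0 ≤ I := integral_nonneg fun x => by positivity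
  -- The factor 2^a appears because P_j is P_1 rescaled by 2^{j-1}, not by 2^j.
  refine ⟨2 ^ a * I, by positivity, fun j => ?_⟩
  rcases le_or_gt j 0 with hj | hj
  · simp only [ρ.kerP_of_nonpos hj]
    simp
    positivity
  · have h := integral_norm_mul_rpow_dilate (g := ρ.symP 1) (g' := ρ.symP j)
      (r := 2 ^ (j - 1)) (by positivity)
      (fun ξ => by rw [ρ.symP_apply hj, ρ.symP_apply le_rfl]; simp) a
    rw [← kerP_eq, ← kerP_eq] at h
    rw [h, ← Real.rpow_intCast, ← Real.rpow_mul two_pos.le]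
    refine le_of_eq ?_
    rw [mul_right_comm, ← Real.rpow_add two_pos]
    push_cast
    ring_nf
    rfl

theorem integrable_kerP_moment (j : ℤ) {a : ℝ} (ha : 0 ≤ a) :
    Integrable fun x => ‖ρ.kerP j x‖ * ‖x‖ ^ a :=
  integrable_norm_mul_norm_rpow _ ha

/-- Using Q_j = P_{j+2} - P_{j+1} treats j = -1 on the same footing as the rings. -/
theorem exists_moment_kerQ_le {a : ℝ} (ha : 0 ≤ a) : ∃ C : ℝ, 0 ≤ C ∧ ∀ j : ℤ, -1 ≤ j →
    ∫ x, ‖ρ.kerQ j x‖ * ‖x‖ ^ a ≤ C * 2 ^ (-(j : ℝ) * a) := by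
  obtain ⟨C, hC0, hC⟩ := ρ.exists_moment_kerP_le a
  refine ⟨C * (2 ^ (-(2 * a)) + 2 ^ (-a)), by positivity, fun j hj => ?_⟩
  have h : ∀ x, ‖ρ.kerQ j x‖ * ‖x‖ ^ a ≤
      ‖ρ.kerP (j + 2) x‖ * ‖x‖ ^ a + ‖ρ.kerP (j + 1) x‖ * ‖x‖ ^ a := by
    intro x
    have : ρ.kerQ j x = ρ.kerP (j + 2) x - ρ.kerP (j + 1) x := by
      rw [ρ.kerP_add_two hj]; simp
    rw [this, ← add_mul]
    gcongr
    exact norm_sub_le _ _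
  have i2 := ρ.integrable_kerP_moment (j + 2) ha
  have i1 := ρ.integrable_kerP_moment (j + 1) ha
  calc _ ≤ ∫ x, (‖ρ.kerP (j + 2) x‖ * ‖x‖ ^ a + ‖ρ.kerP (j + 1) x‖ * ‖x‖ ^ a) :=
        integral_mono (integrable_norm_mul_norm_rpow _ ha) (i2.add i1) h
    _ ≤ C * 2 ^ (-((j + 2 : ℤ) : ℝ) * a) + C * 2 ^ (-((j + 1 : ℤ) : ℝ) * a) := by
        rw [integral_add i2 i1]
        exact add_le_add (hC _) (hC _)
    _ = _ := by
        rw [mul_add, add_mul, mul_assoc C, mul_assoc C, ← Real.rpow_add two_pos,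
          ← Real.rpow_add two_pos]
        push_cast
        ring_nf

theorem exists_integral_norm_kerP_le : ∃ C : ℝ, 0 ≤ C ∧ ∀ j : ℤ, ∫ x, ‖ρ.kerP j x‖ ≤ C := by
  simpa using ρ.exists_moment_kerP_le 0

theorem exists_integral_norm_kerQ_le :
    ∃ C : ℝ, 0 ≤ C ∧ ∀ j : ℤ, -1 ≤ j → ∫ x, ‖ρ.kerQ j x‖ ≤ C := by
  simpa using ρ.exists_moment_kerQ_le le_rfl

end DyadicPartition

end Kernels


/-! ### Distributions whose low-frequency truncations are bounded functions -/

section BoundedBlocks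

variable {d : ℕ}

local notation "𝔼" => EuclideanSpace ℝ (Fin d)

/-- `T` is the tempered distribution `φ ↦ ∫ φ v` of the measurable function `v`, which is bounded
by `C`. -/
structure RepresentedBy (T : 𝓢'(𝔼, ℂ)) (v : 𝔼 → ℂ) (C : ℝ) : Prop where
  meas : AEStronglyMeasurable v
  bound : ∀ x, ‖v x‖ ≤ C
  apply_eq : ∀ φ, T φ = ∫ x, φ x * v x

theorem exists_representedBy_toTemperedDistribution
    (u : Lp ℂ ∞ (volume : Measure 𝔼)) :
    ∃ v, RepresentedBy (Lp.toTemperedDistribution u) v ‖u‖ := by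
  have h1 : ∀ᵐ x, ‖u x‖ ≤ ‖u‖ := by
    have := ae_le_eLpNormEssSup (f := u) (μ := (volume : Measure 𝔼))
    have hfin := Lp.eLpNorm_ne_top u
    rw [eLpNorm_exponent_top] at hfin
    filter_upwards [this] with x hx
    rw [Lp.norm_def, eLpNorm_exponent_top, ← toReal_enorm]
    exact ENNReal.toReal_mono hfin hx
  classical
  -- The representative is set to 0 on a null set, so that the bound holds at every point.
  refine ⟨fun x => if ‖u x‖ ≤ ‖u‖ then u x else 0, ?_, ?_, ?_⟩
  · refine AEStronglyMeasurable.congr (Lp.aestronglyMeasurable u) ?_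
    filter_upwards [h1] with x hx
    rw [if_pos hx]
  · intro x
    by_cases hx : ‖u x‖ ≤ ‖u‖
    · rw [if_pos hx]; exact hx
    · rw [if_neg hx, norm_zero]; exact norm_nonneg _
  · intro φ
    rw [Lp.toTemperedDistribution_apply]
    refine integral_congr_ae ?_
    filter_upwards [h1] with x hx
    rw [if_pos hx, smul_eq_mul]

theorem exists_representedBy_of_linftyNorm_lt {T : 𝓢'(𝔼, ℂ)} {C : ℝ}
    (h : linftyNorm T < ENNReal.ofReal C) : ∃ v, RepresentedBy T v C := by
  simp only [linftyNorm, iInf_lt_iff] at h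
  obtain ⟨u, rfl, hu⟩ := h
  obtain ⟨v, hv⟩ := exists_representedBy_toTemperedDistribution u
  refine ⟨v, hv.meas, fun x => (hv.bound x).trans ?_, hv.apply_eq⟩
  rw [← ofReal_norm] at hu
  exact ((ENNReal.ofReal_lt_ofReal_iff_of_nonneg (norm_nonneg _)).1 hu).le

theorem RepresentedBy.linftyNorm_le {T : 𝓢'(𝔼, ℂ)} {v : 𝔼 → ℂ} {C : ℝ} (hC : 0 ≤ C)
    (h : RepresentedBy T v C) : linftyNorm T ≤ ENNReal.ofReal C := by
  have hm : MemLp v ∞ (volume : Measure 𝔼) :=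
    memLp_top_of_bound h.meas C (Filter.Eventually.of_forall h.bound)
  refine (iInf₂_le (hm.toLp v) ?_).trans ?_
  · ext φ
    rw [Lp.toTemperedDistribution_apply, h.apply_eq]
    refine integral_congr_ae ?_
    filter_upwards [hm.coeFn_toLp] with x hx
    rw [hx, smul_eq_mul]
  · rw [← ofReal_norm]
    refine ENNReal.ofReal_le_ofReal ?_
    rw [Lp.norm_toLp]
    refine ENNReal.toReal_le_of_le_ofReal hC ?_
    exact eLpNormEssSup_le_of_ae_bound (Filter.Eventually.of_forall h.bound)

theorem representedBy_boundedDistribution (f : 𝔼 →ᵇ ℂ) :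
    RepresentedBy (boundedDistribution f) f ‖f‖ := by
  refine ⟨f.continuous.aestronglyMeasurable, f.norm_coe_le_norm, fun φ => ?_⟩
  rw [boundedDistribution, Lp.toTemperedDistribution_apply]
  refine integral_congr_ae ?_
  filter_upwards [MemLp.coeFn_toLp (memLp_top_of_bound (μ := volume)
    f.continuous.aestronglyMeasurable ‖f‖ (Filter.Eventually.of_forall f.norm_coe_le_norm))]
    with x hx
  rw [hx, smul_eq_mul]

theorem RepresentedBy.integrable {T : 𝓢'(𝔼, ℂ)} {v : 𝔼 → ℂ} {C : ℝ} (h : RepresentedBy T v C)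
    (φ : 𝓢(𝔼, ℂ)) : Integrable fun x => φ x * v x :=
  integrable_mul_of_bound φ.integrable h.meas h.bound

theorem RepresentedBy.sub {T S : 𝓢'(𝔼, ℂ)} {v w : 𝔼 → ℂ} {C D : ℝ} (hT : RepresentedBy T v C)
    (hS : RepresentedBy S w D) : RepresentedBy (T - S) (fun x => v x - w x) (C + D) where
  meas := hT.meas.sub hS.meas
  bound x := (norm_sub_le _ _).trans (add_le_add (hT.bound x) (hS.bound x))
  apply_eq φ := by
    simp only [mul_sub]
    rw [integral_sub (hT.integrable φ) (hS.integrable φ), ← hT.apply_eq, ← hS.apply_eq]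
    rfl

theorem RepresentedBy.sum {ι : Type*} {s : Finset ι} {T : ι → 𝓢'(𝔼, ℂ)} {v : ι → 𝔼 → ℂ}
    {C : ι → ℝ} (h : ∀ i ∈ s, RepresentedBy (T i) (v i) (C i)) :
    RepresentedBy (∑ i ∈ s, T i) (fun x => ∑ i ∈ s, v i x) (∑ i ∈ s, C i) where
  meas := by
    have := Finset.aestronglyMeasurable_sum s (fun i hi => (h i hi).meas)
    refine this.congr (Filter.Eventually.of_forall fun x => ?_)
    simp
  bound x := (norm_sum_le _ _).trans (Finset.sum_le_sum fun i hi => (h i hi).bound x)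
  apply_eq φ := by
    simp only [Finset.mul_sum]
    rw [integral_finsetSum s fun i hi => (h i hi).integrable φ]
    rw [← Finset.sum_congr rfl fun i hi => (h i hi).apply_eq φ]
    simp

/-- A bounded function composed with a smoothing Fourier multiplier. -/
theorem RepresentedBy.fourierMultiplier {T : 𝓢'(𝔼, ℂ)} {v : 𝔼 → ℂ} {C : ℝ}
    (hT : RepresentedBy T v C) (g : 𝓢(𝔼, ℂ)) :
    RepresentedBy (TemperedDistribution.fourierMultiplierCLM ℂ g T)
      (convAt (𝓕⁻ g : 𝓢(𝔼, ℂ)) v) ((∫ w, ‖𝓕⁻ g w‖) * C) where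
  meas := (continuous_convAt hT.meas hT.bound).aestronglyMeasurable
  bound := norm_convAt_le (𝓕⁻ g).integrable hT.bound
  apply_eq φ := by
    rw [fourierMultiplierCLM_apply_eq_dualMult, hT.apply_eq,
      integral_dualMult_mul g φ hT.meas hT.bound]

namespace DyadicPartition

variable (ρ : DyadicPartition d)

/-- All low-frequency truncations of `T` are bounded functions. -/
def HasBoundedBlocks (T : 𝓢'(𝔼, ℂ)) : Prop :=
  ∀ k : ℤ, ∃ v C, RepresentedBy (TemperedDistribution.fourierMultiplierCLM ℂ (ρ.symP k) T) v C

/-- The symbol `g` is supported where some low-frequency cut-off is equal to `1`. -/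
def BandLimited (g : 𝓢(𝔼, ℂ)) : Prop := ∃ k : ℤ, ∀ ξ, ρ.symP k ξ * g ξ = g ξ

theorem bandLimited_symP (j : ℤ) : ρ.BandLimited (ρ.symP j) := by
  rcases le_or_gt j 0 with hj | hj
  · exact ⟨0, fun ξ => by simp [ρ.symP_of_nonpos hj]⟩
  · refine ⟨j + 1, fun ξ => ?_⟩
    rcases le_total (2 / 3 * 2 ^ j) ‖ξ‖ with h | h
    · simp [ρ.symP_eq_zero j h]
    · have : (0 : ℝ) < 2 ^ j := by positivity
      rw [ρ.symP_eq_one (by lia), one_mul]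
      rw [zpow_add_one₀ two_ne_zero]
      linarith

theorem symP_mul_symQ {j k : ℤ} (hj : -1 ≤ j) (hk : j + 3 ≤ k) (ξ : 𝔼) :
    ρ.symP k ξ * ρ.symQ j ξ = ρ.symQ j ξ := by
  rcases le_total (8 / 3 * 2 ^ j) ‖ξ‖ with h | h
  · simp [ρ.symQ_eq_zero_of_ge j h]
  · rw [ρ.symP_eq_one (by lia), one_mul]
    have h1 : (2 : ℝ) ^ (j + 3) ≤ 2 ^ k := zpow_le_zpow_right₀ one_le_two hk
    rw [zpow_add₀ two_ne_zero] at h1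
    norm_num at h1
    have : (0 : ℝ) < 2 ^ j := by positivity
    linarith

theorem bandLimited_symQ {j : ℤ} (hj : -1 ≤ j) : ρ.BandLimited (ρ.symQ j) :=
  ⟨j + 3, ρ.symP_mul_symQ hj le_rfl⟩

variable {ρ}

variable {T : 𝓢'(EuclideanSpace ℝ (Fin d), ℂ)} {g : 𝓢(EuclideanSpace ℝ (Fin d), ℂ)}

/-- A band-limited g is unchanged by a suitable cut-off `symP k`, so T may be replaced by its
truncation, a bounded function v. Pairings with T thereby become absolutely convergent integrals. -/
theorem HasBoundedBlocks.exists_convAt (hT : ρ.HasBoundedBlocks T) (hg : ρ.BandLimited g) :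
    ∃ v C, AEStronglyMeasurable v ∧ (∀ x, ‖v x‖ ≤ C) ∧
      (∀ z, T (reflectAt (𝓕⁻ g) z) = convAt (𝓕⁻ g : 𝓢(𝔼, ℂ)) v z) ∧
      ∀ φ, T (dualMult g φ) = ∫ z, φ z * convAt (𝓕⁻ g : 𝓢(𝔼, ℂ)) v z := by
  obtain ⟨k, hk⟩ := hg
  obtain ⟨v, C, hv⟩ := hT k
  refine ⟨v, C, hv.meas, hv.bound, fun z => ?_, fun φ => ?_⟩
  · have h := hv.apply_eq (reflectAt (𝓕⁻ g) z)
    rw [fourierMultiplierCLM_apply_eq_dualMult,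
      dualMult_reflectAt (SchwartzMap.hasTemperateGrowth _) hk] at h
    rw [h]
    simp only [reflectAt_apply, convAt]
  · have h := hv.apply_eq (dualMult g φ)
    rw [fourierMultiplierCLM_apply_eq_dualMult,
      dualMult_dualMult (SchwartzMap.hasTemperateGrowth _) (SchwartzMap.hasTemperateGrowth _)
      (SchwartzMap.hasTemperateGrowth _) hk] at h
    rw [h, integral_dualMult_mul g φ hv.meas hv.bound]

theorem HasBoundedBlocks.continuous_apply_reflectAt (hT : ρ.HasBoundedBlocks T)
    (hg : ρ.BandLimited g) : Continuous fun z => T (reflectAt (𝓕⁻ g) z) := by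
  obtain ⟨v, C, hv, hC, h, -⟩ := hT.exists_convAt hg
  simp only [h]
  exact continuous_convAt hv hC

theorem HasBoundedBlocks.exists_bound_apply_reflectAt (hT : ρ.HasBoundedBlocks T)
    (hg : ρ.BandLimited g) : ∃ C, ∀ z, ‖T (reflectAt (𝓕⁻ g) z)‖ ≤ C := by
  obtain ⟨v, C, hv, hC, h, -⟩ := hT.exists_convAt hg
  refine ⟨(∫ w, ‖𝓕⁻ g w‖) * C, fun z => ?_⟩
  rw [h]
  exact norm_convAt_le (𝓕⁻ g).integrable hC z

/-- This is the form in which T is exchanged with an integral over translates; it serves throughout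
as Fubini's theorem for distributions. -/
theorem HasBoundedBlocks.apply_dualMult (hT : ρ.HasBoundedBlocks T)
    (hg : ρ.BandLimited g) (φ : 𝓢(𝔼, ℂ)) :
    T (dualMult g φ) = ∫ z, φ z * T (reflectAt (𝓕⁻ g) z) := by
  obtain ⟨v, C, hv, hC, h, h'⟩ := hT.exists_convAt hg
  simp only [h, h']

theorem HasBoundedBlocks.sub {S : 𝓢'(𝔼, ℂ)} (hT : ρ.HasBoundedBlocks T)
    (hS : ρ.HasBoundedBlocks S) : ρ.HasBoundedBlocks (T - S) := by
  intro k
  obtain ⟨v, C, hv⟩ := hT k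
  obtain ⟨w, D, hw⟩ := hS k
  exact ⟨_, _, by rw [map_sub]; exact hv.sub hw⟩

theorem hasBoundedBlocks_fourierMultiplier {v : 𝔼 → ℂ} {C : ℝ}
    (hT : RepresentedBy T v C) {q : 𝔼 → ℂ} (hq : q.HasTemperateGrowth) :
    ρ.HasBoundedBlocks (TemperedDistribution.fourierMultiplierCLM ℂ q T) := by
  intro k
  have h := hT.fourierMultiplier (SchwartzMap.smulLeftCLM ℂ q (ρ.symP k))
  rw [SchwartzMap.smulLeftCLM_apply hq] at h
  rw [TemperedDistribution.fourierMultiplierCLM_fourierMultiplierCLM_apply hq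
    (SchwartzMap.hasTemperateGrowth _)]
  exact ⟨_, _, h⟩

theorem hasBoundedBlocks_of_representedBy {v : 𝔼 → ℂ} {C : ℝ}
    (hT : RepresentedBy T v C) : ρ.HasBoundedBlocks T :=
  fun k => ⟨_, _, hT.fourierMultiplier (ρ.symP k)⟩

/-- The `+ 1` makes the inequality strict, so that an L^∞ representative with this bound can be
extracted from the infimum in `linftyNorm`. -/
theorem linftyNorm_block_le {α : ℝ} {C : NNReal} (h : ρ.holderNorm α T ≤ C) {i : ℤ} (hi : -1 ≤ i) :
    linftyNorm (ρ.block i T) < ENNReal.ofReal ((C + 1) * 2 ^ (-(i : ℝ) * α)) := by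
  have h1 : ENNReal.ofReal ((2 : ℝ) ^ (α * i)) * linftyNorm (ρ.block i T) ≤ C :=
    (le_iSup₂ (f := fun (i : ℤ) (_ : -1 ≤ i) =>
      ENNReal.ofReal ((2 : ℝ) ^ (α * i)) * linftyNorm (ρ.block i T)) i hi).trans h
  have hpos : (0 : ℝ) < 2 ^ (α * i) := by positivity
  have h2 : linftyNorm (ρ.block i T) ≤ ENNReal.ofReal (C * 2 ^ (-(i : ℝ) * α)) := by
    have h3 : -(i : ℝ) * α = -(α * i) := by ring
    rw [h3, Real.rpow_neg two_pos.le, ← div_eq_mul_inv, ENNReal.ofReal_div_of_pos hpos,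
      ENNReal.le_div_iff_mul_le (.inl (by simpa using hpos)) (.inl ENNReal.ofReal_ne_top), mul_comm]
    simpa using h1
  refine h2.trans_lt ?_
  rw [ENNReal.ofReal_lt_ofReal_iff (by positivity)]
  gcongr
  linarith

theorem hasBoundedBlocks_of_holderNorm_le {α : ℝ} {C : NNReal} (h : ρ.holderNorm α T ≤ C) :
    ρ.HasBoundedBlocks T := by
  have h1 : ∀ i : ℤ, ∃ v D, -1 ≤ i → RepresentedBy (ρ.block i T) v D := by
    intro i
    by_cases hi : -1 ≤ i
    · obtain ⟨v, hv⟩ := exists_representedBy_of_linftyNorm_lt (linftyNorm_block_le h hi)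
      exact ⟨v, _, fun _ => hv⟩
    · exact ⟨0, 0, fun h => absurd h hi⟩
  choose v D hv using h1
  intro k
  have := RepresentedBy.sum (s := Finset.Icc (-1) (k - 2)) (T := fun i => ρ.block i T)
    (fun i hi => hv i (Finset.mem_Icc.1 hi).1)
  have h2 : TemperedDistribution.fourierMultiplierCLM ℂ (ρ.symP k) T =
      ∑ i ∈ Finset.Icc (-1) (k - 2), ρ.block i T := by
    have h2 := TemperedDistribution.fourierMultiplierCLM_sum ℂ (s := Finset.Icc (-1) (k - 2))
      (g := fun i => ⇑(ρ.symQ i)) fun i _ => SchwartzMap.hasTemperateGrowth _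
    have h3 : ⇑(ρ.symP k) = fun x => ∑ i ∈ Finset.Icc (-1) (k - 2), ρ.symQ i x := by
      funext x; simp [symP]
    rw [h3, h2]
    simp [block, coe_symQ]
  rw [h2]
  exact ⟨_, _, this⟩

/-- The symbol of P_{j+3} equals 1 on the support of ρ_j, so pairing T with Q_j(z - ·) is pairing
the block Δ_jT with P_{j+3}(z - ·). This turns an L^∞ bound on the block into a bound at every z. -/
theorem norm_apply_reflectAt_kerQ_le {j : ℤ} (hj : -1 ≤ j) {v : 𝔼 → ℂ} {C : ℝ}
    (h : RepresentedBy (ρ.block j T) v C) (z : 𝔼) :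
    ‖T (reflectAt (ρ.kerQ j) z)‖ ≤ (∫ x, ‖ρ.kerP (j + 3) x‖) * C := by
  have h1 := h.apply_eq (reflectAt (ρ.kerP (j + 3)) z)
  rw [block, fourierMultiplierCLM_apply_eq_dualMult, ← coe_symQ, kerP_eq,
    dualMult_reflectAt (SchwartzMap.hasTemperateGrowth _) (b := ρ.symQ j), ← kerQ_eq] at h1
  · rw [h1, kerP_eq]
    simp only [reflectAt_apply]
    exact norm_convAt_le (𝓕⁻ (ρ.symP (j + 3))).integrable h.bound z
  · intro ξ
    rw [mul_comm]
    exact ρ.symP_mul_symQ hj le_rfl ξ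

theorem exists_norm_apply_reflectAt_kerQ_le (ρ : DyadicPartition d) (α : ℝ) (C : NNReal) :
    ∃ C' : ℝ, 0 ≤ C' ∧ ∀ T : 𝓢'(𝔼, ℂ), ρ.holderNorm α T ≤ C → ∀ j : ℤ, -1 ≤ j → ∀ z,
      ‖T (reflectAt (ρ.kerQ j) z)‖ ≤ C' * 2 ^ (-(j : ℝ) * α) := by
  obtain ⟨A, hA0, hA⟩ := ρ.exists_integral_norm_kerP_le
  refine ⟨A * (C + 1), by positivity, fun T hT j hj z => ?_⟩
  obtain ⟨v, hv⟩ := exists_representedBy_of_linftyNorm_lt (linftyNorm_block_le hT hj)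
  refine (norm_apply_reflectAt_kerQ_le hj hv z).trans ?_
  rw [mul_assoc]
  gcongr
  exact hA _

end DyadicPartition

end BoundedBlocks


/-! ### The family Λ and the comparison of 𝐐_jΛ with Δ_jΛ_x -/

section Family

variable {d : ℕ}

local notation "𝔼" => EuclideanSpace ℝ (Fin d)

theorem reflectAt_add (φ ψ : 𝓢(𝔼, ℂ)) (x : 𝔼) :
    reflectAt (φ + ψ) x = reflectAt φ x + reflectAt ψ x := by
  simp [reflectAt]

theorem reflectAt_sub (φ ψ : 𝓢(𝔼, ℂ)) (x : 𝔼) :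
    reflectAt (φ - ψ) x = reflectAt φ x - reflectAt ψ x := by
  simp [reflectAt]

namespace DyadicPartition

/-- What is used of the family `Λ`: weak continuity, uniform bounds on the Littlewood-Paley blocks,
and the size of `Λ_y - Λ_z` seen at the point `z` at scale `2^{-j}`. -/
structure RegularFamily (ρ : DyadicPartition d) (γ β₀ : ℝ) {N : ℕ} (a : Fin N → ℝ)
    (Λ : 𝔼 → 𝓢'(𝔼, ℂ)) (B : ℝ) : Prop where
  exponent_pos : ∀ l, 0 < a l
  nonneg : 0 ≤ B
  continuous_apply : ∀ φ, Continuous fun y => Λ y φ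
  hasBoundedBlocks : ∀ y, ρ.HasBoundedBlocks (Λ y)
  bound : ∀ y (j : ℤ), -1 ≤ j → ∀ z, ‖Λ y (reflectAt (ρ.kerQ j) z)‖ ≤ B * 2 ^ (-(j : ℝ) * β₀)
  osc_kerP : ∀ y z (j : ℤ), -1 ≤ j → ‖(Λ y - Λ z) (reflectAt (ρ.kerP j) z)‖ ≤
    B * ∑ l, ‖y - z‖ ^ a l * 2 ^ (-(j : ℝ) * (γ - a l))

variable {ρ : DyadicPartition d}

theorem exists_regularFamily {γ β₀ : ℝ}
    {Λ : 𝔼 → 𝓢'(𝔼, ℂ)} (hΛ : ∃ C : NNReal, ∀ x, ρ.holderNorm β₀ (Λ x) ≤ C)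
    {N : ℕ} {β : Fin N → ℝ} (hβ : ∀ l, β l < γ) {c : Fin N → 𝔼 → 𝔼 → ℝ}
    {Θ : Fin N → 𝔼 → 𝓢'(𝔼, ℂ)}
    (hdec : ∀ x y, Λ y - Λ x = ∑ l, (c l y x : ℂ) • Θ l x)
    (hΘ : ∀ l, ∃ C : ℝ, ∀ x, ∀ j : ℤ, -1 ≤ j →
      (2 : ℝ) ^ ((j : ℝ) * β l) * ‖Θ l x (reflectAt (ρ.kerP j) x)‖ ≤ C)
    (hc : ∀ l, ∃ C : ℝ, ∀ y x, |c l y x| ≤ C * ‖y - x‖ ^ (γ - β l)) :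
    ∃ B, ρ.RegularFamily γ β₀ (fun l => γ - β l) Λ B := by
  obtain ⟨C, hC⟩ := hΛ
  obtain ⟨C₀, hC₀, hC₀'⟩ := ρ.exists_norm_apply_reflectAt_kerQ_le β₀ C
  choose Ct hCt using hΘ
  choose Cc hCc using hc
  have happ : ∀ x y φ, (Λ y - Λ x) φ = ∑ l, (c l y x : ℂ) * Θ l x φ := by
    intro x y φ
    rw [hdec]
    simp
  have hcc : ∀ l y x, |c l y x| ≤ |Cc l| * ‖y - x‖ ^ (γ - β l) := fun l y x =>
    (hCc l y x).trans (by gcongr; exact le_abs_self _)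
  refine ⟨max C₀ (∑ l, |Cc l| * |Ct l|), fun l => sub_pos.2 (hβ l), le_max_of_le_left hC₀, ?_,
    fun y => hasBoundedBlocks_of_holderNorm_le (hC y), ?_, ?_⟩
  · intro φ
    -- In the decomposition based at x the distributions Θ^ℓ_x are fixed, and the coefficients tend
    -- to 0 as y → x since γ - β_ℓ > 0.
    refine continuous_iff_continuousAt.2 fun x => ?_
    have h1 : ∀ y, Λ y φ = Λ x φ + ∑ l, (c l y x : ℂ) * Θ l x φ := by
      intro y
      rw [← happ]
      change _ = _ + (Λ y φ - Λ x φ)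
      ring
    have h2 : ∀ l, Filter.Tendsto (fun y => (c l y x : ℂ)) (nhds x) (nhds 0) := by
      intro l
      have ha : 0 < γ - β l := sub_pos.2 (hβ l)
      have h3 : Filter.Tendsto (fun y => |Cc l| * ‖y - x‖ ^ (γ - β l)) (nhds x) (nhds 0) := by
        have : Continuous fun y => |Cc l| * ‖y - x‖ ^ (γ - β l) :=
          continuous_const.mul ((continuous_id.sub continuous_const).norm.rpow_const
            fun _ => .inr ha.le)
        have := this.tendsto x
        simpa [Real.zero_rpow ha.ne'] using this
      refine squeeze_zero_norm (fun y => ?_) h3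
      simpa using hcc l y x
    have h4 : Filter.Tendsto (fun y => Λ x φ + ∑ l, (c l y x : ℂ) * Θ l x φ) (nhds x)
        (nhds (Λ x φ + ∑ l, 0 * Θ l x φ)) :=
      tendsto_const_nhds.add (tendsto_finsetSum _ fun l _ => (h2 l).mul_const _)
    rw [ContinuousAt]
    simp only [zero_mul, Finset.sum_const_zero, add_zero] at h4
    exact h4.congr fun y => (h1 y).symm
  · intro y j hj z
    refine (hC₀' _ (hC y) j hj z).trans ?_
    gcongr
    exact le_max_left _ _
  · intro y z j hj
    rw [happ]
    refine (norm_sum_le _ _).trans ?_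
    rw [Finset.mul_sum]
    refine Finset.sum_le_sum fun l _ => ?_
    have h1 : ‖Θ l z (reflectAt (ρ.kerP j) z)‖ ≤ |Ct l| * 2 ^ (-(j : ℝ) * β l) := by
      have := (hCt l z j hj).trans (le_abs_self _)
      rw [neg_mul, Real.rpow_neg two_pos.le, ← div_eq_mul_inv, le_div_iff₀ (by positivity)]
      linarith
    have h2 : |Cc l| * |Ct l| ≤ max C₀ (∑ l, |Cc l| * |Ct l|) :=
      (Finset.single_le_sum (f := fun l => |Cc l| * |Ct l|) (fun l _ => by positivity)
        (Finset.mem_univ l)).trans (le_max_right _ _)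
    rw [norm_mul, Complex.norm_real, Real.norm_eq_abs]
    calc _ ≤ (|Cc l| * ‖y - z‖ ^ (γ - β l)) * (|Ct l| * 2 ^ (-(j : ℝ) * β l)) := by
          gcongr
          exact hcc l y z
      _ = (|Cc l| * |Ct l|) * (‖y - z‖ ^ (γ - β l) * 2 ^ (-(j : ℝ) * (γ - (γ - β l)))) := by
          rw [sub_sub_cancel]; ring
      _ ≤ _ := by gcongr

variable {γ β₀ B : ℝ} {N : ℕ} {a : Fin N → ℝ}
  {Λ : EuclideanSpace ℝ (Fin d) → 𝓢'(EuclideanSpace ℝ (Fin d), ℂ)}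

namespace RegularFamily

theorem exists_osc_kerQ (h : ρ.RegularFamily γ β₀ a Λ B) : ∃ B', 0 ≤ B' ∧
    ∀ y z (j : ℤ), -1 ≤ j → ‖(Λ y - Λ z) (reflectAt (ρ.kerQ j) z)‖ ≤
      B' * ∑ l, ‖y - z‖ ^ a l * 2 ^ (-(j : ℝ) * (γ - a l)) := by
  set M := ∑ l, ((2 : ℝ) ^ (-2 * (γ - a l)) + 2 ^ (-1 * (γ - a l)))
  have hM : ∀ l, (2 : ℝ) ^ (-2 * (γ - a l)) + 2 ^ (-1 * (γ - a l)) ≤ M := fun l =>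
    Finset.single_le_sum (f := fun l => (2 : ℝ) ^ (-2 * (γ - a l)) + 2 ^ (-1 * (γ - a l)))
      (fun l _ => by positivity) (Finset.mem_univ l)
  have hB := h.nonneg
  have hM0 : 0 ≤ M := Finset.sum_nonneg fun l _ => by positivity
  refine ⟨B * M, by positivity, fun y z j hj => ?_⟩
  have h1 : ρ.kerQ j = ρ.kerP (j + 2) - ρ.kerP (j + 1) := by rw [ρ.kerP_add_two hj]; abel
  rw [h1, reflectAt_sub, map_sub]
  refine (norm_sub_le _ _).trans ((add_le_add (h.osc_kerP y z (j + 2) (by lia))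
    (h.osc_kerP y z (j + 1) (by lia))).trans ?_)
  rw [← mul_add, mul_assoc, ← Finset.sum_add_distrib, Finset.mul_sum _ _ M]
  gcongr with l
  calc _ = ((2 : ℝ) ^ (-2 * (γ - a l)) + 2 ^ (-1 * (γ - a l))) *
        (‖y - z‖ ^ a l * 2 ^ (-(j : ℝ) * (γ - a l))) := by
        have e1 : (2 : ℝ) ^ (-((j + 2 : ℤ) : ℝ) * (γ - a l)) =
            2 ^ (-2 * (γ - a l)) * 2 ^ (-(j : ℝ) * (γ - a l)) := by
          rw [← Real.rpow_add two_pos]; push_cast; ring_nf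
        have e2 : (2 : ℝ) ^ (-((j + 1 : ℤ) : ℝ) * (γ - a l)) =
            2 ^ (-1 * (γ - a l)) * 2 ^ (-(j : ℝ) * (γ - a l)) := by
          rw [← Real.rpow_add two_pos]; push_cast; ring_nf
        rw [e1, e2]; ring
    _ ≤ _ := by gcongr; exact hM l

/-- A Carathéodory argument: the pairing is continuous in the centre of the kernel for a fixed
distribution, and measurable, even continuous, in the index of the family. -/
theorem stronglyMeasurable_uncurry (h : ρ.RegularFamily γ β₀ a Λ B) {j : ℤ} (hj : -1 ≤ j) :
    StronglyMeasurable fun p : 𝔼 × 𝔼 => Λ p.2 (reflectAt (ρ.kerQ j) p.1) :=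
  stronglyMeasurable_uncurry_of_continuous_of_stronglyMeasurable
    (u := fun x y => Λ y (reflectAt (ρ.kerQ j) x))
    (fun y => (h.hasBoundedBlocks y).continuous_apply_reflectAt (ρ.bandLimited_symQ hj))
    (fun _ => (h.continuous_apply _).stronglyMeasurable)

theorem integrable_kernel (h : ρ.RegularFamily γ β₀ a Λ B) {j : ℤ} (hj : -1 ≤ j) (x : 𝔼) :
    Integrable fun y => ρ.kerP j (x - y) * Λ y (reflectAt (ρ.kerQ j) x) :=
  integrable_mul_of_bound ((ρ.kerP j).integrable.comp_sub_left x)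
    (h.continuous_apply _).aestronglyMeasurable (fun y => h.bound y j hj x)

theorem stronglyMeasurable_bigQ (h : ρ.RegularFamily γ β₀ a Λ B) {j : ℤ} (hj : -1 ≤ j) :
    StronglyMeasurable (ρ.bigQ Λ j) := by
  refine StronglyMeasurable.integral_prod_right
    (f := fun x y => ρ.kerP j (x - y) * Λ y (reflectAt (ρ.kerQ j) x)) ?_
  exact ((ρ.kerP j).continuous.comp (continuous_fst.sub continuous_snd)).stronglyMeasurable.mul
    (h.stronglyMeasurable_uncurry hj)

theorem exists_norm_bigQ_le (h : ρ.RegularFamily γ β₀ a Λ B) : ∃ C, 0 ≤ C ∧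
    ∀ j : ℤ, -1 ≤ j → ∀ x, ‖ρ.bigQ Λ j x‖ ≤ C * 2 ^ (-(j : ℝ) * β₀) := by
  obtain ⟨A, hA0, hA⟩ := ρ.exists_integral_norm_kerP_le
  have hB := h.nonneg
  refine ⟨A * B, by positivity, fun j hj x => ?_⟩
  rw [bigQ, mul_assoc]
  refine (norm_integral_mul_le ((ρ.kerP j).integrable.comp_sub_left x)
    (fun y => h.bound y j hj x)).trans ?_
  rw [integral_sub_left_eq_self (fun w => ‖ρ.kerP j w‖) volume x]
  gcongr
  exact hA j

theorem integrable_mul_bigQ (h : ρ.RegularFamily γ β₀ a Λ B) {j : ℤ} (hj : -1 ≤ j)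
    (φ : 𝓢(𝔼, ℂ)) : Integrable fun x => φ x * ρ.bigQ Λ j x := by
  obtain ⟨C, -, hC⟩ := h.exists_norm_bigQ_le
  exact integrable_mul_of_bound φ.integrable (h.stronglyMeasurable_bigQ hj).aestronglyMeasurable
    (hC j hj)

/-- For fixed y the integrand P_j(x - y) Λ_y(Q_j(x - ·)) is a product of functions of x with
frequencies in |η| < (2/3)2^j and in (3/4)2^j < |ξ| < (8/3)2^j. Here 1/12 = 3/4 - 2/3 and 10/3 = 8/3
+ 2/3; being positive, 1/12 keeps low frequencies out of 𝐐_jΛ. -/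
theorem integral_mul_bigQ_eq_zero (h : ρ.RegularFamily γ β₀ a Λ B) {j : ℤ} (hj : 0 ≤ j)
    {φ : 𝓢(𝔼, ℂ)}
    (hφ : ∀ ξ, 1 / 12 * 2 ^ j < ‖ξ‖ → ‖ξ‖ < 10 / 3 * 2 ^ j → 𝓕⁻ φ ξ = 0) :
    ∫ x, φ x * ρ.bigQ Λ j x = 0 := by
  have hj' : -1 ≤ j := by lia
  simp only [bigQ, ← integral_const_mul]
  rw [integral_integral_swap]
  · refine integral_eq_zero_of_ae (Filter.Eventually.of_forall fun y => ?_)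
    have h1 := (h.hasBoundedBlocks y).apply_dualMult (ρ.bandLimited_symQ hj')
      (SchwartzMap.smulLeftCLM ℂ (SchwartzMap.compSubConstCLM ℂ y (𝓕⁻ (ρ.symP j))) φ)
    have h2 : dualMult (ρ.symQ j)
        (SchwartzMap.smulLeftCLM ℂ (SchwartzMap.compSubConstCLM ℂ y (𝓕⁻ (ρ.symP j))) φ) = 0 := by
      refine schwartz_ext_fourierInv fun ξ => ?_
      rw [fourierInv_dualMult (SchwartzMap.hasTemperateGrowth _)]
      have hz : 𝓕⁻ (0 : 𝓢(𝔼, ℂ)) ξ = 0 := by simp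
      rw [hz]
      by_cases hξ : ρ.symQ j ξ = 0
      · rw [hξ, zero_mul]
      · rw [fourierInv_mul_translate_eq_zero, mul_zero]
        intro η hη
        have b1 : 3 / 4 * 2 ^ j < ‖ξ‖ := not_le.1 fun hle => hξ (ρ.symQ_eq_zero_of_le hj hle)
        have b2 : ‖ξ‖ < 8 / 3 * 2 ^ j := not_le.1 fun hle => hξ (ρ.symQ_eq_zero_of_ge j hle)
        have b3 : ‖η‖ < 2 / 3 * 2 ^ j := not_le.1 fun hle => hη (ρ.symP_eq_zero j hle)
        have b4 : ‖ξ‖ - ‖η‖ ≤ ‖ξ + η‖ := by simpa using norm_sub_norm_le ξ (-η)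
        have b5 := norm_add_le ξ η
        exact hφ _ (by linarith) (by linarith)
    rw [h2, map_zero] at h1
    simp only [Pi.zero_apply]
    rw [h1]
    refine integral_congr_ae (Filter.Eventually.of_forall fun x => ?_)
    simp only [SchwartzMap.smulLeftCLM_apply_apply (SchwartzMap.hasTemperateGrowth _),
      SchwartzMap.compSubConstCLM_apply, smul_eq_mul, ← kerP_eq, ← kerQ_eq]
    ring
  · have h3 := (integrable_prod_mul_sub φ.integrable (ρ.kerP j).integrable).mul_bdd
      (h.stronglyMeasurable_uncurry hj').aestronglyMeasurable
      (Filter.Eventually.of_forall fun p => h.bound p.2 j hj' p.1)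
    refine h3.congr (Filter.Eventually.of_forall fun p => ?_)
    simp only [Function.uncurry]
    ring

/-- The main estimate. As ∫P_j = 1, the term Λ_x(Q_j(z - ·)) can be put under the y-integral. The
increment Λ_y - Λ_z then contributes a moment of P_j of size 2^{-j a_ℓ}, hence 2^{-jγ}, while Λ_x -
Λ_z contributes |x - z|^{a_ℓ}. -/
theorem exists_norm_bigQ_sub_le (h : ρ.RegularFamily γ β₀ a Λ B) : ∃ C, 0 ≤ C ∧
    ∀ j : ℤ, 1 ≤ j → ∀ x z, ‖ρ.bigQ Λ j z - Λ x (reflectAt (ρ.kerQ j) z)‖ ≤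
      C * ∑ l, (2 ^ (-(j : ℝ) * γ) + ‖x - z‖ ^ a l * 2 ^ (-(j : ℝ) * (γ - a l))) := by
  obtain ⟨B', hB', hosc⟩ := h.exists_osc_kerQ
  obtain ⟨A, hA0, hA⟩ := ρ.exists_integral_norm_kerP_le
  choose m hm0 hm using fun l => ρ.exists_moment_kerP_le (a l)
  set M := A + ∑ l, m l
  have hmM : ∀ l, m l ≤ M := fun l =>
    (Finset.single_le_sum (fun l _ => hm0 l) (Finset.mem_univ l)).trans (le_add_of_nonneg_left hA0)
  have hAM : A ≤ M := le_add_of_nonneg_right (Finset.sum_nonneg fun l _ => hm0 l)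
  have hM0 : 0 ≤ M := hA0.trans hAM
  refine ⟨B' * M, by positivity, fun j hj x z => ?_⟩
  have e1 : ρ.bigQ Λ j z - Λ x (reflectAt (ρ.kerQ j) z) =
      ∫ y, ρ.kerP j (z - y) * (Λ y - Λ x) (reflectAt (ρ.kerQ j) z) := by
    have e2 : Λ x (reflectAt (ρ.kerQ j) z) =
        ∫ y, ρ.kerP j (z - y) * Λ x (reflectAt (ρ.kerQ j) z) := by
      rw [integral_mul_const, integral_sub_left_eq_self (fun w => ρ.kerP j w) volume z,
        ρ.integral_kerP hj, one_mul]
    rw [e2, bigQ, ← integral_sub (h.integrable_kernel (by lia) z)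
      (((ρ.kerP j).integrable.comp_sub_left z).mul_const _)]
    refine integral_congr_ae (Filter.Eventually.of_forall fun y => ?_)
    change _ = _ * (Λ y _ - Λ x _)
    ring
  have i0 : ∀ l, Integrable fun y => ‖ρ.kerP j (z - y)‖ * ‖z - y‖ ^ a l := fun l =>
    (ρ.integrable_kerP_moment j (h.exponent_pos l).le).comp_sub_left z
  have i1 : Integrable fun y => ‖ρ.kerP j (z - y)‖ := (ρ.kerP j).integrable.norm.comp_sub_left z
  rw [e1]
  set D : Fin N → ℝ := fun l => 2 ^ (-(j : ℝ) * (γ - a l))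
  have i2 : ∀ l, Integrable fun y =>
      B' * ((‖ρ.kerP j (z - y)‖ * ‖z - y‖ ^ a l + ‖ρ.kerP j (z - y)‖ * ‖x - z‖ ^ a l) * D l) :=
    fun l => (((i0 l).add (i1.mul_const _)).mul_const _).const_mul _
  calc _ ≤ ∫ y, ∑ l, B' * ((‖ρ.kerP j (z - y)‖ * ‖z - y‖ ^ a l +
        ‖ρ.kerP j (z - y)‖ * ‖x - z‖ ^ a l) * D l) := by
        refine norm_integral_le_of_norm_le (integrable_finsetSum _ fun l _ => i2 l)
          (Filter.Eventually.of_forall fun y => ?_)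
        -- Both increments must be based at z, the centre of the test function, since only there are
        -- the Θ^ℓ controlled.
        have e3 : Λ y - Λ x = (Λ y - Λ z) - (Λ x - Λ z) := by abel
        rw [norm_mul, e3]
        change ‖_‖ * ‖(Λ y - Λ z) _ - (Λ x - Λ z) _‖ ≤ _
        calc _ ≤ ‖ρ.kerP j (z - y)‖ * (B' * ∑ l, ‖y - z‖ ^ a l * D l +
              B' * ∑ l, ‖x - z‖ ^ a l * D l) := by
              gcongr
              exact (norm_sub_le _ _).trans
                (add_le_add (hosc y z j (by lia)) (hosc x z j (by lia)))
          _ = _ := by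
              rw [← mul_add, ← Finset.sum_add_distrib, Finset.mul_sum, Finset.mul_sum]
              refine Finset.sum_congr rfl fun l _ => ?_
              rw [norm_sub_rev y z]
              ring
    _ = ∑ l, B' * (((∫ y, ‖ρ.kerP j y‖ * ‖y‖ ^ a l) +
        (∫ y, ‖ρ.kerP j y‖) * ‖x - z‖ ^ a l) * D l) := by
        rw [integral_finsetSum _ fun l _ => i2 l]
        refine Finset.sum_congr rfl fun l _ => ?_
        rw [integral_const_mul, integral_mul_const, integral_add (i0 l) (i1.mul_const _),
          integral_mul_const, integral_sub_left_eq_self (fun w => ‖ρ.kerP j w‖) volume z,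
          integral_sub_left_eq_self (fun w => ‖ρ.kerP j w‖ * ‖w‖ ^ a l) volume z]
    _ ≤ ∑ l, B' * ((M * 2 ^ (-(j : ℝ) * a l) + M * ‖x - z‖ ^ a l) * D l) := by
        gcongr with l
        · exact (hm l j).trans (by gcongr; exact hmM l)
        · exact (hA j).trans hAM
    _ = _ := by
        rw [Finset.mul_sum]
        refine Finset.sum_congr rfl fun l _ => ?_
        have e4 : (2 : ℝ) ^ (-(j : ℝ) * γ) = 2 ^ (-(j : ℝ) * a l) * D l := by
          rw [← Real.rpow_add two_pos]; ring_nf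
        rw [e4]
        ring

end RegularFamily

end DyadicPartition

end Family


/-! ### Convergence of the paraproduct series -/

section Paraproduct

variable {d : ℕ}

local notation "𝔼" => EuclideanSpace ℝ (Fin d)

theorem exists_schwartz_dilate (g : 𝓢(𝔼, ℂ)) {r : ℝ} (hr : r ≠ 0) :
    ∃ g' : 𝓢(𝔼, ℂ), ∀ ξ, g' ξ = g (r⁻¹ • ξ) :=
  ⟨SchwartzMap.compCLMOfContinuousLinearEquiv ℂ
    (ContinuousLinearEquiv.smulLeft (Units.mk0 r⁻¹ (inv_ne_zero hr))) g, fun ξ => by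
      simp [Units.smul_def]⟩

/-- The symbol `‖ξ‖ ^ (2 m)`. -/
def normPow (m : ℕ) (ξ : 𝔼) : ℂ := (((‖ξ‖ ^ 2) ^ m : ℝ) : ℂ)

theorem hasTemperateGrowth_normPow (m : ℕ) : (normPow (d := d) m).HasTemperateGrowth := by
  have h1 : (fun ξ : 𝔼 => (‖ξ‖ ^ 2) ^ m).HasTemperateGrowth :=
    (Function.hasTemperateGrowth_norm_sq 𝔼).pow m
  exact Function.Complex.hasTemperateGrowth_ofReal.comp h1

theorem normPow_smul (m : ℕ) (r : ℝ) (ξ : 𝔼) :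
    normPow m (r • ξ) = (((r ^ 2) ^ m : ℝ) : ℂ) * normPow m ξ := by
  simp only [normPow, norm_smul, mul_pow, Real.norm_eq_abs, sq_abs]
  push_cast
  rfl

namespace DyadicPartition

theorem exists_inverse_normPow (ρ : DyadicPartition d) (m : ℕ) :
    ∃ κ : 𝓢(𝔼, ℂ), ∀ ξ, 1 / 12 < ‖ξ‖ → ‖ξ‖ < 10 / 3 → κ ξ * normPow m ξ = 1 := by
  -- The numerator is 1 for 1/12 ≤ |ξ| ≤ 6, which covers the spectral annulus at scale j = 0. It
  -- vanishes for |ξ| < 3/64, where both terms are 1, and for |ξ| ≥ 11, where both are 0.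
  set num : 𝔼 → ℝ := fun ξ => ρ.low ((8 : ℝ)⁻¹ • ξ) - ρ.low ((16 : ℝ) • ξ)
  set f : 𝔼 → ℝ := fun ξ => num ξ * ((‖ξ‖ ^ 2) ^ m)⁻¹
  have hnum : ContDiff ℝ ∞ num :=
    (ρ.low_smooth.comp (contDiff_const_smul _)).sub (ρ.low_smooth.comp (contDiff_const_smul _))
  have hf : ContDiff ℝ ∞ f := by
    refine contDiff_iff_contDiffAt.2 fun ξ => ?_
    rcases eq_or_ne ξ 0 with rfl | hξ
    · have : f =ᶠ[nhds 0] fun _ => 0 := by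
        filter_upwards [Metric.ball_mem_nhds (0 : 𝔼) (ε := 3 / 64) (by norm_num)] with ξ hξ
        rw [mem_ball_zero_iff] at hξ
        have h1 : ρ.low ((8 : ℝ)⁻¹ • ξ) = 1 :=
          ρ.low_eq_one (by rw [norm_smul]; norm_num; linarith)
        have h2 : ρ.low ((16 : ℝ) • ξ) = 1 :=
          ρ.low_eq_one (by rw [norm_smul]; norm_num; linarith)
        simp [f, num, h1, h2]
      exact contDiffAt_const.congr_of_eventuallyEq this
    · exact hnum.contDiffAt.mul (((contDiff_norm_sq ℝ).contDiffAt.pow m).inv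
        (pow_ne_zero _ (pow_ne_zero _ (norm_ne_zero_iff.2 hξ))))
  have hcf : HasCompactSupport f := by
    refine HasCompactSupport.of_support_subset_isCompact (isCompact_closedBall (0 : 𝔼) 11) ?_
    intro ξ hξ
    rw [mem_closedBall_zero_iff]
    by_contra hlt
    push Not at hlt
    have h1 : ρ.low ((8 : ℝ)⁻¹ • ξ) = 0 :=
      ρ.low_eq_zero (by rw [norm_smul]; norm_num; linarith)
    have h2 : ρ.low ((16 : ℝ) • ξ) = 0 :=
      ρ.low_eq_zero (by rw [norm_smul]; norm_num; linarith)
    exact hξ (by simp [f, num, h1, h2])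
  refine ⟨(hcf.comp_left (g := fun t : ℝ => (t : ℂ)) (by simp)).toSchwartzMap
    (Complex.ofRealCLM.contDiff.comp hf), fun ξ h1 h2 => ?_⟩
  have e1 : ρ.low ((8 : ℝ)⁻¹ • ξ) = 1 :=
    ρ.low_eq_one (by rw [norm_smul]; norm_num; linarith)
  have e2 : ρ.low ((16 : ℝ) • ξ) = 0 :=
    ρ.low_eq_zero (by rw [norm_smul]; norm_num; linarith)
  have hpos : 0 < ‖ξ‖ := by linarith
  change ((f ξ : ℝ) : ℂ) * normPow m ξ = 1
  rw [normPow, ← Complex.ofReal_mul]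
  simp only [f, num, e1, e2, sub_zero, one_mul]
  rw [inv_mul_cancel₀ (by positivity), Complex.ofReal_one]

namespace RegularFamily

variable {ρ : DyadicPartition d} {γ β₀ B : ℝ} {N : ℕ} {a : Fin N → ℝ}
  {Λ : EuclideanSpace ℝ (Fin d) → 𝓢'(EuclideanSpace ℝ (Fin d), ℂ)}

/-- On its spectral annulus 𝐐_jΛ is the multiplier |ξ|^{2m} applied to a function G_j of size
2^{-j(2m+β₀)}. For m large the G_j are summable in L^∞, and the limit is the multiplier applied to
their sum. This form also shows that its truncations are bounded. -/
theorem exists_isParaproduct (h : ρ.RegularFamily γ β₀ a Λ B) :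
    ∃ T : 𝓢'(𝔼, ℂ), ρ.IsParaproduct Λ T ∧ ρ.HasBoundedBlocks T := by
  obtain ⟨C, hC0, hC⟩ := h.exists_norm_bigQ_le
  -- Then 2m + β₀ ≥ 1, so ‖G_j‖ ≲ 2^{-j}, with at least one power of 2^{-j} for summability.
  obtain ⟨m, hm⟩ : ∃ m : ℕ, 1 - β₀ ≤ 2 * m := by
    obtain ⟨m, hm⟩ := exists_nat_ge (1 - β₀)
    exact ⟨m, by linarith [Nat.cast_nonneg (α := ℝ) m]⟩
  obtain ⟨κ, hκ⟩ := ρ.exists_inverse_normPow m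
  choose κ' hκ' using fun j : ℤ => exists_schwartz_dilate κ (r := 2 ^ j) (by positivity)
  set A := ∫ x, ‖𝓕⁻ κ x‖
  have hA0 : 0 ≤ A := integral_nonneg fun x => norm_nonneg _
  have hA : ∀ j, ∫ x, ‖𝓕⁻ (κ' j) x‖ = A := by
    intro j
    have := integral_norm_mul_rpow_dilate (r := 2 ^ j) (by positivity) (hκ' j) 0
    simpa using this
  have hTG := hasTemperateGrowth_normPow (d := d) m
  -- With s_j = 2^{-2mj}, the product of s_j, κ(2^{-j}ξ) and |ξ|^{2m} is 1 on the annulus of 𝐐_jΛ.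
  set s : ℤ → ℂ := fun j => ((((((2 : ℝ) ^ j)⁻¹) ^ 2) ^ m : ℝ) : ℂ)
  have hs : ∀ j, ‖s j‖ = 2 ^ (-(j : ℝ) * (2 * m)) := by
    intro j
    simp only [s]
    rw [Complex.norm_real, Real.norm_of_nonneg (by positivity), ← pow_mul, ← Real.rpow_intCast,
      ← Real.rpow_neg two_pos.le, ← Real.rpow_natCast, ← Real.rpow_mul two_pos.le]
    push_cast
    rfl
  set G : ℤ → 𝔼 → ℂ := fun j x => s j * convAt (𝓕⁻ (κ' j) : 𝓢(𝔼, ℂ)) (ρ.bigQ Λ j) x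
  have hGb : ∀ j : ℤ, 1 ≤ j → ∀ x, ‖G j x‖ ≤ A * C * 2 ^ (-(j : ℝ)) := by
    intro j hj x
    have hjR : (1 : ℝ) ≤ j := by exact_mod_cast hj
    have h1 := norm_convAt_le (𝓕⁻ (κ' j)).integrable (hC j (by lia)) x
    rw [hA] at h1
    calc ‖G j x‖ ≤ 2 ^ (-(j : ℝ) * (2 * m)) * (A * (C * 2 ^ (-(j : ℝ) * β₀))) := by
          rw [norm_mul, hs]; gcongr
      _ = A * C * 2 ^ (-(j : ℝ) * (2 * m + β₀)) := by
          rw [mul_add, Real.rpow_add two_pos]; ring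
      _ ≤ _ := by
          gcongr
          · exact one_le_two
          · nlinarith
  have hGm : ∀ j : ℤ, 1 ≤ j → AEStronglyMeasurable (G j) := by
    intro j hj
    exact (continuous_const.mul (continuous_convAt
      (h.stronglyMeasurable_bigQ (by lia)).aestronglyMeasurable
      (hC j (by lia)))).aestronglyMeasurable
  have hGint : ∀ j : ℤ, 1 ≤ j → ∀ φ, ∫ x, dualMult (normPow m) φ x * G j x =
      ∫ x, φ x * ρ.bigQ Λ j x := by
    intro j hj φ
    have hmeas := (h.stronglyMeasurable_bigQ (j := j) (by lia)).aestronglyMeasurable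
      (μ := volume)
    have e1 : ∫ x, dualMult (normPow m) φ x * G j x =
        ∫ x, (s j • dualMult (κ' j) (dualMult (normPow m) φ)) x * ρ.bigQ Λ j x := by
      simp only [G, smul_apply, smul_eq_mul, mul_assoc, mul_left_comm _ (s j)]
      rw [integral_const_mul, integral_const_mul,
        integral_dualMult_mul (κ' j) _ hmeas (hC j (by lia))]
    rw [e1, ← sub_eq_zero, ← integral_sub (h.integrable_mul_bigQ (by lia) _)
      (h.integrable_mul_bigQ (by lia) _)]
    -- The two test functions have the same frequencies on the annulus of 𝐐_jΛ, so their difference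
    -- integrates to 0 against it.
    have e2 := h.integral_mul_bigQ_eq_zero (j := j) (by lia)
      (φ := s j • dualMult (κ' j) (dualMult (normPow m) φ) - φ) ?_
    · rw [← e2]
      refine integral_congr_ae (Filter.Eventually.of_forall fun x => ?_)
      simp only [sub_apply]
      ring
    · intro ξ h1 h2
      have e3 : 𝓕⁻ (s j • dualMult (κ' j) (dualMult (normPow m) φ) - φ) ξ =
          s j * (κ' j ξ * (normPow m ξ * 𝓕⁻ φ ξ)) - 𝓕⁻ φ ξ := by
        rw [← fourierInv_dualMult hTG, ← fourierInv_dualMult (SchwartzMap.hasTemperateGrowth _)]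
        simp [sub_eq_add_neg]
      have h2j : (0 : ℝ) < 2 ^ j := by positivity
      have e4 := hκ (((2 : ℝ) ^ j)⁻¹ • ξ)
        (by rw [norm_two_zpow_inv_smul, lt_div_iff₀ h2j]; exact h1)
        (by rw [norm_two_zpow_inv_smul, div_lt_iff₀ h2j]; exact h2)
      rw [normPow_smul, ← hκ'] at e4
      rw [e3]
      linear_combination 𝓕⁻ φ ξ * e4
  have hLp : ∀ n : ℕ, MemLp (G (n + 1)) ∞ (volume : Measure 𝔼) := fun n =>
    memLp_top_of_bound (hGm _ (by lia)) _ (Filter.Eventually.of_forall (hGb _ (by lia)))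
  set u : ℕ → Lp ℂ ∞ (volume : Measure 𝔼) := fun n => (hLp n).toLp (G (n + 1))
  have hu : ∀ n, ‖u n‖ ≤ A * C * (1 / 2) ^ n := by
    intro n
    rw [Lp.norm_toLp]
    refine ENNReal.toReal_le_of_le_ofReal (by positivity) ?_
    refine eLpNormEssSup_le_of_ae_bound (Filter.Eventually.of_forall fun x => ?_)
    refine (hGb _ (by lia) x).trans ?_
    gcongr
    rw [one_div, inv_pow, ← Real.rpow_natCast, ← Real.rpow_neg two_pos.le]
    gcongr
    · exact one_le_two
    · push_cast; linarith
  have hsum : Summable u := Summable.of_norm_bounded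
    ((summable_geometric_of_lt_one (by norm_num) (by norm_num : (1 / 2 : ℝ) < 1)).mul_left _) hu
  set U : 𝓢'(𝔼, ℂ) := Lp.toTemperedDistributionCLM ℂ volume ∞ (∑' n, u n)
  refine ⟨TemperedDistribution.fourierMultiplierCLM ℂ (normPow m) U, ⟨?_, ?_, ?_⟩, ?_⟩
  · exact fun j hj x => h.integrable_kernel (by lia) x
  · exact fun j hj φ => h.integrable_mul_bigQ (by lia) φ
  · intro φ
    have h1 := hsum.hasSum.mapL (Lp.toTemperedDistributionCLM ℂ (volume : Measure 𝔼) ∞)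
    have h2 := h1.mapL (PointwiseConvergenceCLM.evalCLM (RingHom.id ℂ) ℂ
      (dualMult (normPow m) φ))
    have h3 : ∀ n : ℕ, ∫ x, φ x * ρ.bigQ Λ (n + 1) x =
        Lp.toTemperedDistributionCLM ℂ (volume : Measure 𝔼) ∞ (u n) (dualMult (normPow m) φ) := by
      intro n
      rw [← hGint _ (by lia), Lp.toTemperedDistributionCLM_apply, Lp.toTemperedDistribution_apply]
      refine integral_congr_ae ?_
      filter_upwards [(hLp n).coeFn_toLp] with x hx
      rw [hx, smul_eq_mul]
    simp only [h3]
    exact h2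
  · obtain ⟨v, hv⟩ := exists_representedBy_toTemperedDistribution (∑' n, u n)
    exact hasBoundedBlocks_fourierMultiplier hv hTG

end RegularFamily

end DyadicPartition

end Paraproduct


/-! ### Frequency-localised tests and reconstruction for γ < 0 -/

section Reconstruction

variable {d : ℕ}

local notation "𝔼" => EuclideanSpace ℝ (Fin d)

theorem exists_sum_two_rpow_le {t : ℝ} (ht : 0 < t) : ∃ C : ℝ, 0 ≤ C ∧ ∀ n : ℤ, 0 ≤ n →
    ∑ j ∈ Finset.Icc 1 n, (2 : ℝ) ^ ((j : ℝ) * t) ≤ C * 2 ^ ((n : ℝ) * t) := by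
  have hlt : (2 : ℝ) ^ (-t) < 1 := Real.rpow_lt_one_of_one_lt_of_neg one_lt_two (by linarith)
  have hpos : 0 < 1 - (2 : ℝ) ^ (-t) := by linarith
  -- This C solves C = 1 + C 2^{-t}, so the induction step closes with equality.
  refine ⟨1 / (1 - 2 ^ (-t)), by positivity, fun n hn => ?_⟩
  induction n, hn using Int.leInduction with
  | base => simp; exact hlt.le
  | succ n hn ih =>
    have h1 : Finset.Icc 1 (n + 1) = insert (n + 1) (Finset.Icc 1 n) := by
      ext j; simp only [Finset.mem_Icc, Finset.mem_insert]; lia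
    rw [h1, Finset.sum_insert (by simp)]
    have h2 : (2 : ℝ) ^ ((n : ℝ) * t) = 2 ^ (((n + 1 : ℤ) : ℝ) * t) * 2 ^ (-t) := by
      rw [← Real.rpow_add two_pos]; push_cast; ring_nf
    rw [h2] at ih
    refine (add_le_add_right ih _).trans (le_of_eq ?_)
    field_simp
    ring

namespace DyadicPartition

theorem exists_kernel_moments (ρ : DyadicPartition d) {N : ℕ} {a : Fin N → ℝ} (ha : ∀ l, 0 < a l) :
    ∃ M : ℝ, 0 ≤ M ∧ ∀ i : ℤ, -1 ≤ i →
      ((∫ x, ‖ρ.kerP i x‖ ≤ M) ∧ ∀ l, ∫ x, ‖ρ.kerP i x‖ * ‖x‖ ^ a l ≤ M * 2 ^ (-(i : ℝ) * a l)) ∧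
      ((∫ x, ‖ρ.kerQ i x‖ ≤ M) ∧
        ∀ l, ∫ x, ‖ρ.kerQ i x‖ * ‖x‖ ^ a l ≤ M * 2 ^ (-(i : ℝ) * a l)) := by
  obtain ⟨A, hA0, hA⟩ := ρ.exists_integral_norm_kerP_le
  obtain ⟨A', hA0', hA'⟩ := ρ.exists_integral_norm_kerQ_le
  choose m hm0 hm using fun l => ρ.exists_moment_kerP_le (a l)
  choose m' hm0' hm' using fun l => ρ.exists_moment_kerQ_le (ha l).le
  have hs := Finset.sum_nonneg fun l (_ : l ∈ Finset.univ) => hm0 l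
  have hs' := Finset.sum_nonneg fun l (_ : l ∈ Finset.univ) => hm0' l
  have h1 := fun l => Finset.single_le_sum (fun l _ => hm0 l) (Finset.mem_univ l)
  have h1' := fun l => Finset.single_le_sum (fun l _ => hm0' l) (Finset.mem_univ l)
  refine ⟨A + A' + ∑ l, m l + ∑ l, m' l, by positivity, fun i hi => ⟨⟨?_, fun l => ?_⟩, ?_,
    fun l => ?_⟩⟩
  · linarith [hA i]
  · exact (hm l i).trans (by gcongr; linarith [h1 l])
  · linarith [hA' i hi]
  · exact (hm' l i hi).trans (by gcongr; linarith [h1' l])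

variable {ρ : DyadicPartition d} {γ β₀ B : ℝ} {N : ℕ} {a : Fin N → ℝ}
  {Λ : EuclideanSpace ℝ (Fin d) → 𝓢'(EuclideanSpace ℝ (Fin d), ℂ)}
  {T : 𝓢'(EuclideanSpace ℝ (Fin d), ℂ)}

theorem IsParaproduct.apply_eq_sum (hT : ρ.IsParaproduct Λ T) (h : ρ.RegularFamily γ β₀ a Λ B)
    {i : ℤ} (hi : 0 ≤ i) {φ : 𝓢(𝔼, ℂ)} (hφ : ∀ ξ, 2 / 3 * 2 ^ i ≤ ‖ξ‖ → 𝓕⁻ φ ξ = 0) :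
    T φ = ∑ j ∈ Finset.Icc 1 (i + 2), ∫ x, φ x * ρ.bigQ Λ j x := by
  have h1 := hT.hasSum φ
  obtain ⟨n, rfl⟩ := Int.eq_ofNat_of_zero_le hi
  -- The index k carries 𝐐_{k+1}. For k ≥ n + 2 its annulus starts at or above 2^{n+3}/12 =
  -- (2/3)2^n, beyond the spectrum of φ.
  have h2 : ∀ k ∉ Finset.range (n + 2), ∫ x, φ x * ρ.bigQ Λ (k + 1) x = 0 := by
    intro k hk
    rw [Finset.mem_range, not_lt] at hk
    refine h.integral_mul_bigQ_eq_zero (by lia) fun ξ hξ _ => hφ ξ ?_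
    have h3 : (2 : ℝ) ^ ((n : ℤ) + 3) ≤ 2 ^ ((k : ℤ) + 1) :=
      zpow_le_zpow_right₀ one_le_two (by lia)
    rw [zpow_add₀ two_ne_zero] at h3
    norm_num at h3 hξ ⊢
    linarith
  rw [h1.unique (hasSum_sum_of_ne_finset_zero h2)]
  refine Finset.sum_bij (fun k _ => (k : ℤ) + 1) ?_ ?_ ?_ ?_
  · intro k hk; simp only [Finset.mem_range, Finset.mem_Icc] at *; lia
  · intro k _ k' _ hkk; lia
  · intro j hj
    simp only [Finset.mem_Icc] at hj
    exact ⟨(j - 1).toNat, by simp only [Finset.mem_range]; lia, by lia⟩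
  · intro k _; rfl

theorem symP_eq_add_sum {n : ℤ} (hn : 2 ≤ n) (ξ : 𝔼) :
    ρ.symP n ξ = ρ.symP 2 ξ + ∑ j ∈ Finset.Icc 1 (n - 2), ρ.symQ j ξ := by
  have h1 : Finset.Icc (-1) (n - 2) = Finset.Icc (-1) 0 ∪ Finset.Icc 1 (n - 2) := by
    ext j; simp only [Finset.mem_Icc, Finset.mem_union]; lia
  have h2 : Disjoint (Finset.Icc (-1 : ℤ) 0) (Finset.Icc 1 (n - 2)) := by
    rw [Finset.disjoint_left]; intro j; simp only [Finset.mem_Icc]; lia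
  simp only [symP, h1, Finset.sum_union h2]
  simp

namespace RegularFamily

/-- On the spectrum of φ the symbol of P_{i+4} is 1, so Λ_x may be split into the same blocks 1 ≤ j
≤ i + 2 as 𝐏(Λ). The blocks -1 and 0, which have no counterpart in 𝐏(Λ), are gathered in `symP 2`.
-/
theorem apply_eq_sum (h : ρ.RegularFamily γ β₀ a Λ B) {i : ℤ} (hi : 0 ≤ i) {φ : 𝓢(𝔼, ℂ)}
    (hφ : ∀ ξ, 2 / 3 * 2 ^ i ≤ ‖ξ‖ → 𝓕⁻ φ ξ = 0) (x : 𝔼) :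
    Λ x φ = Λ x (dualMult (ρ.symP 2) φ) +
      ∑ j ∈ Finset.Icc 1 (i + 2), ∫ z, φ z * Λ x (reflectAt (ρ.kerQ j) z) := by
  have h1 : φ = dualMult (ρ.symP 2) φ +
      ∑ j ∈ Finset.Icc 1 (i + 2), dualMult (ρ.symQ j) φ := by
    refine schwartz_ext_fourierInv fun ξ => ?_
    have h2 : 𝓕⁻ (dualMult (ρ.symP 2) φ + ∑ j ∈ Finset.Icc 1 (i + 2), dualMult (ρ.symQ j) φ) ξ =
        ρ.symP (i + 4) ξ * 𝓕⁻ φ ξ := by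
      have h3 : 𝓕⁻ (dualMult (ρ.symP 2) φ + ∑ j ∈ Finset.Icc 1 (i + 2), dualMult (ρ.symQ j) φ) =
          𝓕⁻ (dualMult (ρ.symP 2) φ) +
            ∑ j ∈ Finset.Icc 1 (i + 2), 𝓕⁻ (dualMult (ρ.symQ j) φ) := by
        have := map_add (FourierTransform.fourierInvCLM ℂ 𝓢(𝔼, ℂ)) (dualMult (ρ.symP 2) φ)
          (∑ j ∈ Finset.Icc 1 (i + 2), dualMult (ρ.symQ j) φ)
        rw [map_sum] at this
        exact this
      rw [h3, symP_eq_add_sum (by lia), show i + 4 - 2 = i + 2 by ring, add_apply, sum_apply,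
        add_mul, Finset.sum_mul, fourierInv_dualMult (SchwartzMap.hasTemperateGrowth _)]
      congr 1
      exact Finset.sum_congr rfl fun j _ => fourierInv_dualMult (SchwartzMap.hasTemperateGrowth _) _ _
    rw [h2]
    rcases le_total (2 / 3 * 2 ^ i) ‖ξ‖ with h4 | h4
    · rw [hφ ξ h4, mul_zero]
    · have : (0 : ℝ) < 2 ^ i := by positivity
      rw [ρ.symP_eq_one (by lia), one_mul]
      rw [zpow_add₀ two_ne_zero]
      norm_num
      linarith
  conv_lhs => rw [h1]
  rw [map_add, map_sum]
  congr 1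
  refine Finset.sum_congr rfl fun j hj => ?_
  have hj' := (Finset.mem_Icc.1 hj).1
  exact (h.hasBoundedBlocks x).apply_dualMult (ρ.bandLimited_symQ (by lia)) φ

theorem integrable_mul_apply (h : ρ.RegularFamily γ β₀ a Λ B) {j : ℤ} (hj : -1 ≤ j)
    (φ : 𝓢(𝔼, ℂ)) (x : 𝔼) : Integrable fun z => φ z * Λ x (reflectAt (ρ.kerQ j) z) :=
  integrable_mul_of_bound φ.integrable ((h.hasBoundedBlocks x).continuous_apply_reflectAt
    (ρ.bandLimited_symQ hj)).aestronglyMeasurable (fun z => h.bound x j hj z)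

theorem integral_mul_sub (h : ρ.RegularFamily γ β₀ a Λ B) {j : ℤ} (hj : -1 ≤ j)
    (φ : 𝓢(𝔼, ℂ)) (x : 𝔼) :
    ∫ z, φ z * (ρ.bigQ Λ j z - Λ x (reflectAt (ρ.kerQ j) z)) =
      (∫ z, φ z * ρ.bigQ Λ j z) - ∫ z, φ z * Λ x (reflectAt (ρ.kerQ j) z) := by
  simp only [mul_sub]
  exact integral_sub (h.integrable_mul_bigQ hj φ) (h.integrable_mul_apply hj φ x)

theorem sub_apply_eq (h : ρ.RegularFamily γ β₀ a Λ B) (hT : ρ.IsParaproduct Λ T) {i : ℤ}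
    (hi : 0 ≤ i) {φ : 𝓢(𝔼, ℂ)} (hφ : ∀ ξ, 2 / 3 * 2 ^ i ≤ ‖ξ‖ → 𝓕⁻ φ ξ = 0) (x : 𝔼) :
    (T - Λ x) φ = (∑ j ∈ Finset.Icc 1 (i + 2),
      ∫ z, φ z * (ρ.bigQ Λ j z - Λ x (reflectAt (ρ.kerQ j) z))) -
        Λ x (dualMult (ρ.symP 2) φ) := by
  change T φ - Λ x φ = _
  rw [hT.apply_eq_sum h hi hφ, h.apply_eq_sum hi hφ x, Finset.sum_congr rfl fun j hj =>
    h.integral_mul_sub (by have := (Finset.mem_Icc.1 hj).1; lia) φ x, Finset.sum_sub_distrib]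
  ring

theorem integral_mul_sub_eq_zero (h : ρ.RegularFamily γ β₀ a Λ B) {j : ℤ} (hj : 0 ≤ j)
    {φ : 𝓢(𝔼, ℂ)}
    (hφ : ∀ ξ, 1 / 12 * 2 ^ j < ‖ξ‖ → ‖ξ‖ < 10 / 3 * 2 ^ j → 𝓕⁻ φ ξ = 0) (x : 𝔼) :
    ∫ z, φ z * (ρ.bigQ Λ j z - Λ x (reflectAt (ρ.kerQ j) z)) = 0 := by
  rw [h.integral_mul_sub (by lia), h.integral_mul_bigQ_eq_zero hj hφ, zero_sub, neg_eq_zero]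
  have h1 := (h.hasBoundedBlocks x).apply_dualMult (ρ.bandLimited_symQ (j := j) (by lia)) φ
  rw [← kerQ_eq] at h1
  have h2 : dualMult (ρ.symQ j) φ = 0 := by
    refine schwartz_ext_fourierInv fun ξ => ?_
    rw [fourierInv_dualMult (SchwartzMap.hasTemperateGrowth _)]
    have hz : 𝓕⁻ (0 : 𝓢(𝔼, ℂ)) ξ = 0 := by simp
    rw [hz]
    have : (0 : ℝ) < 2 ^ j := by positivity
    by_cases hξ : ρ.symQ j ξ = 0
    · rw [hξ, zero_mul]
    · have b1 : 3 / 4 * 2 ^ j < ‖ξ‖ := not_le.1 fun hle => hξ (ρ.symQ_eq_zero_of_le hj hle)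
      have b2 : ‖ξ‖ < 8 / 3 * 2 ^ j := not_le.1 fun hle => hξ (ρ.symQ_eq_zero_of_ge j hle)
      rw [hφ ξ (by linarith) (by linarith), mul_zero]
  rw [← h1, h2, map_zero]

/-- The main estimate integrated against K(x - ·): the moments of K, a kernel of scale 2^{-i}, turn
|x - z|^{a_ℓ} into 2^{-i a_ℓ}. Leaving K general serves both P_i and Q_k. -/
theorem exists_norm_integral_reflectAt_le (h : ρ.RegularFamily γ β₀ a Λ B) : ∃ C, 0 ≤ C ∧
    ∀ (K : 𝓢(𝔼, ℂ)) (M : ℝ) (i j : ℤ), 0 ≤ M → 1 ≤ j → (∫ w, ‖K w‖) ≤ M →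
      (∀ l, ∫ w, ‖K w‖ * ‖w‖ ^ a l ≤ M * 2 ^ (-(i : ℝ) * a l)) → ∀ x,
      ‖∫ z, reflectAt K x z * (ρ.bigQ Λ j z - Λ x (reflectAt (ρ.kerQ j) z))‖ ≤
        C * M * ∑ l, (2 ^ (-(j : ℝ) * γ) + 2 ^ (-(i : ℝ) * a l) * 2 ^ (-(j : ℝ) * (γ - a l))) := by
  obtain ⟨C, hC0, hC⟩ := h.exists_norm_bigQ_sub_le
  refine ⟨C, hC0, fun K M i j hM hj hK0 hKa x => ?_⟩
  set D : Fin N → ℝ := fun l => 2 ^ (-(j : ℝ) * (γ - a l))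
  set t : ℝ := 2 ^ (-(j : ℝ) * γ)
  have i0 : ∀ l, Integrable fun z => ‖K (x - z)‖ * ‖x - z‖ ^ a l := fun l =>
    (integrable_norm_mul_norm_rpow K (h.exponent_pos l).le).comp_sub_left x
  have i1 : Integrable fun z => ‖K (x - z)‖ := K.integrable.norm.comp_sub_left x
  have i2 : ∀ l, Integrable fun z =>
      C * (‖K (x - z)‖ * t + ‖K (x - z)‖ * ‖x - z‖ ^ a l * D l) :=
    fun l => ((i1.mul_const _).add ((i0 l).mul_const _)).const_mul _
  calc _ ≤ ∫ z, ∑ l, C * (‖K (x - z)‖ * t + ‖K (x - z)‖ * ‖x - z‖ ^ a l * D l) := by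
        refine norm_integral_le_of_norm_le (integrable_finsetSum _ fun l _ => i2 l)
          (Filter.Eventually.of_forall fun z => ?_)
        rw [norm_mul, reflectAt_apply]
        refine (mul_le_mul_of_nonneg_left (hC j hj x z) (norm_nonneg _)).trans (le_of_eq ?_)
        rw [Finset.mul_sum, Finset.mul_sum]
        refine Finset.sum_congr rfl fun l _ => ?_
        ring
    _ = ∑ l, C * ((∫ w, ‖K w‖) * t + (∫ w, ‖K w‖ * ‖w‖ ^ a l) * D l) := by
        rw [integral_finsetSum _ fun l _ => i2 l]
        refine Finset.sum_congr rfl fun l _ => ?_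
        rw [integral_const_mul, integral_add (i1.mul_const _) ((i0 l).mul_const _),
          integral_mul_const, integral_mul_const,
          integral_sub_left_eq_self (fun w => ‖K w‖) volume x,
          integral_sub_left_eq_self (fun w => ‖K w‖ * ‖w‖ ^ a l) volume x]
    _ ≤ ∑ l, C * (M * t + M * 2 ^ (-(i : ℝ) * a l) * D l) := by
        gcongr with l
        exact hKa l
    _ = _ := by
        rw [Finset.mul_sum]
        refine Finset.sum_congr rfl fun l _ => ?_
        ring

theorem exists_norm_apply_dualMult_symP_two_le (h : ρ.RegularFamily γ β₀ a Λ B) : ∃ C, 0 ≤ C ∧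
    ∀ (K : 𝓢(𝔼, ℂ)) (x : 𝔼),
      ‖Λ x (dualMult (ρ.symP 2) (reflectAt K x))‖ ≤ (∫ w, ‖K w‖) * C := by
  have hB := h.nonneg
  have hbd : ∀ x z, ‖Λ x (reflectAt (ρ.kerP 2) z)‖ ≤ B * 2 ^ β₀ + B := by
    intro x z
    have e1 : ρ.kerP 2 = ρ.kerQ (-1) + ρ.kerQ 0 := by
      have h1 := ρ.kerP_add_two (j := 0) (by lia)
      have h2 := ρ.kerP_add_two (j := -1) (by lia)
      norm_num at h1 h2
      rw [h1, h2, ρ.kerP_of_nonpos le_rfl, zero_add]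
    rw [e1, reflectAt_add, map_add]
    refine (norm_add_le _ _).trans (add_le_add ?_ ?_)
    · simpa using h.bound x (-1) le_rfl z
    · simpa using h.bound x 0 (by lia) z
  refine ⟨B * 2 ^ β₀ + B, by positivity, fun K x => ?_⟩
  rw [(h.hasBoundedBlocks x).apply_dualMult (ρ.bandLimited_symP 2)]
  simp only [reflectAt_apply, ← kerP_eq]
  rw [← integral_sub_left_eq_self (fun w => ‖K w‖) volume x]
  exact norm_integral_mul_le (K.integrable.comp_sub_left x) (hbd x)

theorem fourierInv_reflectAt_kerP_eq_zero (i : ℤ) (x : 𝔼) {ξ : 𝔼} (h : 2 / 3 * 2 ^ i ≤ ‖ξ‖) :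
    𝓕⁻ (reflectAt (ρ.kerP i) x) ξ = 0 := by
  rw [kerP_eq, fourierInv_reflectAt_fourierInv, ρ.symP_eq_zero i h, mul_zero]

theorem fourierInv_reflectAt_kerQ_eq_zero_of_ge (i : ℤ) (x : 𝔼) {ξ : 𝔼}
    (h : 8 / 3 * 2 ^ i ≤ ‖ξ‖) : 𝓕⁻ (reflectAt (ρ.kerQ i) x) ξ = 0 := by
  rw [kerQ_eq, fourierInv_reflectAt_fourierInv, ρ.symQ_eq_zero_of_ge i h, mul_zero]

theorem fourierInv_reflectAt_kerQ_eq_zero_of_le {i : ℤ} (hi : 0 ≤ i) (x : 𝔼) {ξ : 𝔼}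
    (h : ‖ξ‖ ≤ 3 / 4 * 2 ^ i) : 𝓕⁻ (reflectAt (ρ.kerQ i) x) ξ = 0 := by
  rw [kerQ_eq, fourierInv_reflectAt_fourierInv, ρ.symQ_eq_zero_of_le hi h, mul_zero]

/-- Both 2^{-jγ} and 2^{-j(γ - a_ℓ)} grow with j, so their sums over j ≤ i + 2 are comparable to
their last terms; the factor 2^{-i a_ℓ} then restores 2^{-iγ} in the second. -/
theorem reconstructs_of_neg (h : ρ.RegularFamily γ β₀ a Λ B) (hT : ρ.IsParaproduct Λ T)
    (hγ : γ < 0) : ρ.Reconstructs γ Λ T := by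
  obtain ⟨M, hM0, hM⟩ := ρ.exists_kernel_moments h.exponent_pos
  obtain ⟨C, hC0, hC⟩ := h.exists_norm_integral_reflectAt_le
  obtain ⟨L, hL0, hL⟩ := h.exists_norm_apply_dualMult_symP_two_le
  obtain ⟨S, hS0, hS⟩ := exists_sum_two_rpow_le (t := -γ) (by linarith)
  choose S' hS0' hS' using fun l => exists_sum_two_rpow_le (t := a l - γ)
    (by linarith [h.exponent_pos l])
  have hE : 0 ≤ ∑ l, (S * 2 ^ (2 * -γ) + S' l * 2 ^ (2 * (a l - γ))) :=
    Finset.sum_nonneg fun l _ => by have := hS0' l; positivity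
  -- The factors with exponents 2·(-γ) and 2(a_ℓ - γ) pay for summing up to i + 2 instead of i; M *
  -- L is the contribution of the blocks -1 and 0.
  refine ⟨C * M * (∑ l, (S * 2 ^ (2 * -γ) + S' l * 2 ^ (2 * (a l - γ)))) + M * L,
    fun x i hi => ?_⟩
  rcases le_or_gt i 0 with hi0 | hi0
  · rw [ρ.kerP_of_nonpos hi0]
    have : reflectAt (0 : 𝓢(𝔼, ℂ)) x = 0 := by simp [reflectAt]
    rw [this, map_zero, norm_zero]
    positivity
  · obtain ⟨⟨m1, m2⟩, -⟩ := hM i hi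
    rw [h.sub_apply_eq hT hi0.le (fun ξ => fourierInv_reflectAt_kerP_eq_zero i x), add_mul]
    refine (norm_sub_le _ _).trans (add_le_add ?_ ?_)
    · refine (norm_sum_le _ _).trans ((Finset.sum_le_sum fun j hj => hC (ρ.kerP i) M i j hM0
        (Finset.mem_Icc.1 hj).1 m1 m2 x).trans ?_)
      rw [← Finset.mul_sum, Finset.sum_comm, mul_assoc (C * M), Finset.sum_mul]
      gcongr with l
      rw [Finset.sum_add_distrib, ← Finset.mul_sum, add_mul]
      refine add_le_add ?_ ?_
      · have e1 : ∀ j : ℤ, (2 : ℝ) ^ (-(j : ℝ) * γ) = 2 ^ ((j : ℝ) * -γ) := fun j => by ring_nf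
        simp only [e1]
        refine (hS (i + 2) (by lia)).trans (le_of_eq ?_)
        rw [mul_assoc, ← Real.rpow_add two_pos]
        push_cast
        ring_nf
      · have e1 : ∀ j : ℤ, (2 : ℝ) ^ (-(j : ℝ) * (γ - a l)) = 2 ^ ((j : ℝ) * (a l - γ)) :=
          fun j => by ring_nf
        simp only [e1]
        refine (mul_le_mul_of_nonneg_left (hS' l (i + 2) (by lia)) (by positivity)).trans
          (le_of_eq ?_)
        rw [mul_left_comm, ← Real.rpow_add two_pos, mul_assoc, ← Real.rpow_add two_pos]
        push_cast
        ring_nf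
    -- The blocks -1 and 0 contribute O(1), which is absorbed because 2^{-iγ} ≥ 1 when γ < 0.
    · have hiR : (0 : ℝ) < i := by exact_mod_cast hi0
      have h1 : (1 : ℝ) ≤ 2 ^ (-(i : ℝ) * γ) :=
        Real.one_le_rpow one_le_two (by nlinarith)
      calc _ ≤ (∫ w, ‖ρ.kerP i w‖) * L := hL _ x
        _ ≤ M * L := by gcongr
        _ ≤ _ := le_mul_of_one_le_right (by positivity) h1

end RegularFamily

end DyadicPartition

end Reconstruction


/-! ### The case γ > 0: the limit function -/

section PositiveExponent

variable {d : ℕ}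

local notation "𝔼" => EuclideanSpace ℝ (Fin d)

namespace DyadicPartition

variable {ρ : DyadicPartition d} {γ β₀ B : ℝ} {N : ℕ} {a : Fin N → ℝ}
  {Λ : EuclideanSpace ℝ (Fin d) → 𝓢'(EuclideanSpace ℝ (Fin d), ℂ)}
  {T : 𝓢'(EuclideanSpace ℝ (Fin d), ℂ)}

theorem reflectAt_kerP_of_nonpos {i : ℤ} (hi : i ≤ 0) (x : 𝔼) : reflectAt (ρ.kerP i) x = 0 := by
  rw [ρ.kerP_of_nonpos hi]
  simp [reflectAt]

theorem reflectAt_kerP_succ {n : ℤ} (hn : 0 ≤ n) (x : 𝔼) :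
    reflectAt (ρ.kerP (n + 1)) x = reflectAt (ρ.kerP n) x + reflectAt (ρ.kerQ (n - 1)) x := by
  have h1 := ρ.kerP_add_two (j := n - 1) (by lia)
  rw [show n - 1 + 2 = n + 1 by ring, show n - 1 + 1 = n by ring] at h1
  rw [h1, reflectAt_add]

theorem convAt_eq_apply {K : 𝓢(𝔼, ℂ)} {S : 𝓢'(𝔼, ℂ)} {v : 𝔼 → ℂ} {C : ℝ}
    (hS : RepresentedBy S v C) (x : 𝔼) : S (reflectAt K x) = convAt K v x := by
  rw [hS.apply_eq]
  simp only [reflectAt_apply, convAt]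

theorem tendsto_convAt_kerP (ρ : DyadicPartition d) (f : 𝔼 →ᵇ ℂ) (x : 𝔼) :
    Filter.Tendsto (fun n : ℕ => convAt (ρ.kerP (n + 1)) f x) Filter.atTop (nhds (f x)) := by
  have h1 : ∀ n : ℕ, convAt (ρ.kerP (n + 1)) f x =
      ∫ w, ρ.kerP 1 w * f (x - ((2 : ℝ) ^ n)⁻¹ • w) := by
    intro n
    have h2 : ∀ w, ρ.kerP (n + 1) w = (((2 : ℝ) ^ n : ℝ) : ℂ) ^ d * ρ.kerP 1 ((2 : ℝ) ^ n • w) := by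
      intro w
      rw [kerP_eq, kerP_eq]
      refine fourierInv_dilate (by positivity) (fun ξ => ?_) w
      rw [ρ.symP_apply (by lia), ρ.symP_apply le_rfl]
      simp
    rw [convAt, ← integral_sub_left_eq_self _ volume x]
    simp only [sub_sub_cancel, h2]
    have h3 := Measure.integral_comp_smul_of_nonneg (volume : Measure 𝔼)
      (fun w : 𝔼 => ρ.kerP 1 w * f (x - ((2 : ℝ) ^ n)⁻¹ • w)) (2 ^ n) (hR := by positivity)
    simp only [finrank_euclideanSpace, Fintype.card_fin] at h3
    rw [Complex.real_smul] at h3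
    have h4 : (((((2 : ℝ) ^ n) ^ d)⁻¹ : ℝ) : ℂ) ≠ 0 := by
      exact_mod_cast (by positivity : ((((2 : ℝ) ^ n) ^ d)⁻¹ : ℝ) ≠ 0)
    rw [← mul_right_inj' h4, ← h3, ← integral_const_mul]
    refine integral_congr_ae (Filter.Eventually.of_forall fun w => ?_)
    simp only [smul_smul]
    rw [inv_mul_cancel₀ (by positivity), one_smul]
    have h5 : (((((2 : ℝ) ^ n) ^ d)⁻¹ : ℝ) : ℂ) * (((2 : ℝ) ^ n : ℝ) : ℂ) ^ d = 1 := by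
      rw [← Complex.ofReal_pow, ← Complex.ofReal_mul, inv_mul_cancel₀ (by positivity),
        Complex.ofReal_one]
    linear_combination (ρ.kerP 1 ((2 : ℝ) ^ n • w) * f (x - w)) * h5
  simp only [h1]
  have h6 : f x = ∫ w, ρ.kerP 1 w * f x := by
    rw [integral_mul_const, ρ.integral_kerP le_rfl, one_mul]
  rw [h6]
  refine tendsto_integral_of_dominated_convergence (fun w => ‖ρ.kerP 1 w‖ * ‖f‖) (fun n => ?_)
    ((ρ.kerP 1).integrable.norm.mul_const _) (fun n => Filter.Eventually.of_forall fun w => ?_)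
    (Filter.Eventually.of_forall fun w => ?_)
  · exact ((ρ.kerP 1).continuous.mul (f.continuous.comp
      (continuous_const.sub (continuous_const_smul _)))).aestronglyMeasurable
  · rw [norm_mul]
    gcongr
    exact f.norm_coe_le_norm _
  · refine tendsto_const_nhds.mul ((f.continuous.tendsto x).comp ?_)
    have h7 : Filter.Tendsto (fun n : ℕ => ((2 : ℝ) ^ n)⁻¹) Filter.atTop (nhds 0) := by
      simpa [inv_pow] using tendsto_pow_atTop_nhds_zero_of_lt_one (r := (2 : ℝ)⁻¹)
        (by norm_num) (by norm_num)
    simpa using tendsto_const_nhds.sub (h7.smul_const w)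

/-- Truncating φ below frequency 2^n recovers φ in the Schwartz topology, while S applied to the
truncation is the integral of φ against the pairings assumed to be small. -/
theorem eq_zero_of_tendsto {S : 𝓢'(𝔼, ℂ)} (hS : ρ.HasBoundedBlocks S) {b : ℕ → ℝ}
    (hb : Filter.Tendsto b Filter.atTop (nhds 0))
    (h : ∀ (n : ℕ) x, ‖S (reflectAt (ρ.kerP (n + 1)) x)‖ ≤ b n) : S = 0 := by
  ext φ
  have h1 : Filter.Tendsto (fun n : ℕ => dualMult (ρ.symP (n + 1)) φ) Filter.atTop (nhds φ) := by
    have h2 := tendsto_smulLeftCLM_dilate (χ := ρ.symP 1) (χs := fun n : ℕ => ρ.symP (n + 1))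
      (r := 3 / 4) (by norm_num)
      (fun ξ hξ => ρ.symP_eq_one le_rfl (by norm_num; linarith))
      (fun n ξ => by rw [ρ.symP_apply (by lia), ρ.symP_apply le_rfl]; simp) (𝓕⁻ φ)
    have h3 := ((FourierTransform.fourierCLM ℂ 𝓢(𝔼, ℂ)).continuous.tendsto _).comp h2
    simpa [dualMult, Function.comp_def] using h3
  have h4 : Filter.Tendsto (fun n : ℕ => S (dualMult (ρ.symP (n + 1)) φ)) Filter.atTop
      (nhds (S φ)) := (S.continuous.tendsto φ).comp h1
  refine tendsto_nhds_unique h4 ?_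
  have h5 : Filter.Tendsto (fun n => (∫ z, ‖φ z‖) * b n) Filter.atTop (nhds 0) := by
    simpa using hb.const_mul (∫ z, ‖φ z‖)
  refine squeeze_zero_norm (fun n => ?_) h5
  rw [hS.apply_dualMult (ρ.bandLimited_symP _), ← kerP_eq]
  exact norm_integral_mul_le φ.integrable (h n)

theorem IsParaproduct.isRealDistribution (hT : ρ.IsParaproduct Λ T)
    (hΛ : ∀ x, IsRealDistribution (Λ x)) : IsRealDistribution T := by
  have him : ∀ (f : 𝔼 → ℂ), (∀ x, (f x).im = 0) → (∫ x, f x).im = 0 := by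
    intro f hf
    rw [← Complex.conj_eq_iff_im, ← integral_conj]
    exact integral_congr_ae (Filter.Eventually.of_forall fun x => Complex.conj_eq_iff_im.2 (hf x))
  have hmul : ∀ z w : ℂ, z.im = 0 → w.im = 0 → (z * w).im = 0 := by
    intro z w hz hw
    simp [Complex.mul_im, hz, hw]
  intro φ hφ
  refine (Complex.hasSum_im (hT.hasSum φ)).unique ?_
  have h0 : (fun n : ℕ => (∫ x, φ x * ρ.bigQ Λ (n + 1) x).im) = fun _ => 0 := by
    funext n
    refine him _ fun x => hmul _ _ (hφ x) (him _ fun y => hmul _ _ (ρ.im_kerP _ _) ?_)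
    exact hΛ y _ fun z => by rw [reflectAt_apply]; exact ρ.im_kerQ _ _
  rw [h0]
  exact hasSum_zero

namespace RegularFamily

/-- Unlike P_i, the kernel Q_k is blind to small j as well as to large j, so only k - 2 ≤ j ≤ k + 4
matter. No sum over scales remains, and each term is of size 2^{-kγ}. -/
theorem exists_norm_sub_apply_kerQ_le (h : ρ.RegularFamily γ β₀ a Λ B)
    (hT : ρ.IsParaproduct Λ T) (hγ : 0 < γ) : ∃ C, 0 ≤ C ∧ ∀ k : ℤ, -1 ≤ k → ∀ x,
      ‖(T - Λ x) (reflectAt (ρ.kerQ k) x)‖ ≤ C * 2 ^ (-(k : ℝ) * γ) := by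
  obtain ⟨M, hM0, hM⟩ := ρ.exists_kernel_moments h.exponent_pos
  obtain ⟨C, hC0, hC⟩ := h.exists_norm_integral_reflectAt_le
  obtain ⟨L, hL0, hL⟩ := h.exists_norm_apply_dualMult_symP_two_le
  set E := ∑ l, ((2 : ℝ) ^ (2 * γ) + 2 ^ (4 * |γ - a l|))
  have hE : 0 ≤ E := Finset.sum_nonneg fun l _ => by positivity
  -- At most seven indices j survive. In E, 2^{2γ} reflects j ≥ k - 2 and 2^{4|γ - a_ℓ|} reflects |j
  -- - k| ≤ 4.
  refine ⟨7 * (C * M * E) + M * L * 2 ^ γ, by positivity, fun k hk x => ?_⟩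
  obtain ⟨-, m1, m2⟩ := hM k hk
  have hφ : ∀ ξ, 2 / 3 * 2 ^ (k + 2) ≤ ‖ξ‖ → 𝓕⁻ (reflectAt (ρ.kerQ k) x) ξ = 0 := by
    intro ξ hξ
    refine fourierInv_reflectAt_kerQ_eq_zero_of_ge k x ?_
    rw [zpow_add₀ two_ne_zero] at hξ
    norm_num at hξ
    linarith
  rw [h.sub_apply_eq hT (by lia) hφ, add_mul]
  refine (norm_sub_le _ _).trans (add_le_add ?_ ?_)
  · have hsub : ∑ j ∈ Finset.Icc 1 (k + 2 + 2), ∫ z, reflectAt (ρ.kerQ k) x z *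
          (ρ.bigQ Λ j z - Λ x (reflectAt (ρ.kerQ j) z)) =
        ∑ j ∈ (Finset.Icc (k - 2) (k + 4)).filter (1 ≤ ·), ∫ z, reflectAt (ρ.kerQ k) x z *
          (ρ.bigQ Λ j z - Λ x (reflectAt (ρ.kerQ j) z)) := by
      symm
      refine Finset.sum_subset ?_ ?_
      · intro j; simp only [Finset.mem_filter, Finset.mem_Icc]; lia
      · intro j hj hj'
        simp only [Finset.mem_filter, Finset.mem_Icc] at hj hj'
        refine h.integral_mul_sub_eq_zero (by lia) (fun ξ _ h2 => ?_) x
        refine fourierInv_reflectAt_kerQ_eq_zero_of_le (by lia) x ?_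
        have h3 : (2 : ℝ) ^ (j + 3) ≤ 2 ^ k := zpow_le_zpow_right₀ one_le_two (by lia)
        rw [zpow_add₀ two_ne_zero] at h3
        norm_num at h3
        have : (0 : ℝ) < 2 ^ j := by positivity
        linarith
    rw [hsub]
    have hterm : ∀ j ∈ (Finset.Icc (k - 2) (k + 4)).filter (1 ≤ ·),
        ‖∫ z, reflectAt (ρ.kerQ k) x z * (ρ.bigQ Λ j z - Λ x (reflectAt (ρ.kerQ j) z))‖ ≤
          C * M * E * 2 ^ (-(k : ℝ) * γ) := by
      intro j hj
      simp only [Finset.mem_filter, Finset.mem_Icc] at hj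
      have hjk1 : (k : ℝ) - 2 ≤ j := by exact_mod_cast hj.1.1
      have hjk2 : (j : ℝ) ≤ k + 4 := by exact_mod_cast hj.1.2
      refine (hC (ρ.kerQ k) M k j hM0 hj.2 m1 m2 x).trans ?_
      rw [mul_assoc (C * M), Finset.sum_mul]
      gcongr with l
      rw [add_mul, ← Real.rpow_add two_pos, ← Real.rpow_add two_pos, ← Real.rpow_add two_pos]
      refine add_le_add (Real.rpow_le_rpow_of_exponent_le one_le_two ?_)
        (Real.rpow_le_rpow_of_exponent_le one_le_two ?_)
      · nlinarith
      · have h4 : -((j : ℝ) - k) * (γ - a l) ≤ 4 * |γ - a l| := by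
          refine (le_abs_self _).trans ?_
          rw [abs_mul, abs_neg]
          gcongr
          rw [abs_le]
          constructor <;> linarith
        linarith
    refine (norm_sum_le_of_le _ hterm).trans ?_
    rw [Finset.sum_const, nsmul_eq_mul, ← mul_assoc]
    have hcard : ((Finset.Icc (k - 2) (k + 4)).filter (1 ≤ ·)).card ≤ 7 := by
      refine (Finset.card_filter_le _ _).trans ?_
      rw [Int.card_Icc]
      lia
    have : ((((Finset.Icc (k - 2) (k + 4)).filter (1 ≤ ·)).card : ℕ) : ℝ) ≤ 7 := by
      exact_mod_cast hcard
    gcongr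
  -- The blocks -1 and 0 meet Q_k only for k ≤ 1: P_2 has frequencies below 8/3, and Q_k above 3
  -- once k ≥ 2.
  · rcases le_or_gt k 1 with hk1 | hk1
    · have hkR : (k : ℝ) ≤ 1 := by exact_mod_cast hk1
      have h1 : (1 : ℝ) ≤ 2 ^ γ * 2 ^ (-(k : ℝ) * γ) := by
        rw [← Real.rpow_add two_pos]
        exact Real.one_le_rpow one_le_two (by nlinarith)
      calc _ ≤ (∫ w, ‖ρ.kerQ k w‖) * L := hL _ x
        _ ≤ M * L := by gcongr
        _ ≤ M * L * (2 ^ γ * 2 ^ (-(k : ℝ) * γ)) := le_mul_of_one_le_right (by positivity) h1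
        _ = _ := by ring
    · have h1 : dualMult (ρ.symP 2) (reflectAt (ρ.kerQ k) x) = 0 := by
        refine schwartz_ext_fourierInv fun ξ => ?_
        rw [fourierInv_dualMult (SchwartzMap.hasTemperateGrowth _)]
        have hz : 𝓕⁻ (0 : 𝓢(𝔼, ℂ)) ξ = 0 := by simp
        rw [hz]
        rcases le_total ‖ξ‖ (3 / 4 * 2 ^ k) with h2 | h2
        · rw [fourierInv_reflectAt_kerQ_eq_zero_of_le (by lia) x h2, mul_zero]
        · rw [ρ.symP_eq_zero, zero_mul]
          have h3 : (2 : ℝ) ^ (2 : ℤ) ≤ 2 ^ k := zpow_le_zpow_right₀ one_le_two (by lia)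
          linarith
      rw [h1, map_zero, norm_zero]
      positivity

theorem continuous_apply_diag (h : ρ.RegularFamily γ β₀ a Λ B) {n : ℤ} (hn : -1 ≤ n) :
    Continuous fun x => Λ x (reflectAt (ρ.kerP n) x) := by
  refine continuous_iff_continuousAt.2 fun x₀ => ?_
  have h1 : (fun x => Λ x (reflectAt (ρ.kerP n) x)) = fun x =>
      Λ x₀ (reflectAt (ρ.kerP n) x) - (Λ x₀ - Λ x) (reflectAt (ρ.kerP n) x) := by
    funext x
    change _ = Λ x₀ _ - (Λ x₀ _ - Λ x _)
    ring
  have h2 : Filter.Tendsto (fun x => (Λ x₀ - Λ x) (reflectAt (ρ.kerP n) x)) (nhds x₀) (nhds 0) := by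
    have h3 : Continuous fun x => B * ∑ l, ‖x₀ - x‖ ^ a l * 2 ^ (-(n : ℝ) * (γ - a l)) :=
      continuous_const.mul (continuous_finsetSum _ fun l _ =>
        ((continuous_const.sub continuous_id).norm.rpow_const
          fun _ => .inr (h.exponent_pos l).le).mul continuous_const)
    have h4 := h3.tendsto x₀
    have h5 : B * ∑ l, ‖x₀ - x₀‖ ^ a l * 2 ^ (-(n : ℝ) * (γ - a l)) = 0 := by
      simp [Real.zero_rpow (h.exponent_pos _).ne']
    rw [h5] at h4
    exact squeeze_zero_norm (fun x => h.osc_kerP x₀ x n hn) h4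
  rw [ContinuousAt, h1]
  have h6 := (h.hasBoundedBlocks x₀).continuous_apply_reflectAt (ρ.bandLimited_symP n)
  rw [← kerP_eq] at h6
  have h7 := (h6.tendsto x₀).sub h2
  rw [sub_zero] at h7
  exact h7

/-- Consecutive terms differ by the pairing with Q_{n-1}(x - ·), of size 2^{-(n-1)γ}, so the
sequence is uniformly Cauchy with a geometric rate. The limit inherits continuity from the terms. -/
theorem exists_limit (h : ρ.RegularFamily γ β₀ a Λ B)
    (hT : ρ.IsParaproduct Λ T) (hTb : ρ.HasBoundedBlocks T) (hγ : 0 < γ) :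
    ∃ (f : 𝔼 →ᵇ ℂ) (C : ℝ), 0 ≤ C ∧
      (∀ x, Filter.Tendsto (fun n : ℕ => (T - Λ x) (reflectAt (ρ.kerP n) x)) Filter.atTop
        (nhds (f x))) ∧
      ∀ (n : ℕ) x, ‖(T - Λ x) (reflectAt (ρ.kerP n) x) - f x‖ ≤ C * 2 ^ (-(n : ℝ) * γ) := by
  obtain ⟨C, hC0, hC⟩ := h.exists_norm_sub_apply_kerQ_le hT hγ
  set r : ℝ := 2 ^ (-γ)
  have hr0 : 0 < r := by positivity
  have hr1 : r < 1 := Real.rpow_lt_one_of_one_lt_of_neg one_lt_two (by linarith)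
  have hrn : ∀ n : ℕ, (2 : ℝ) ^ (-(n : ℝ) * γ) = r ^ n := by
    intro n
    rw [← Real.rpow_natCast, ← Real.rpow_mul two_pos.le]
    ring_nf
  set H : ℕ → 𝔼 → ℂ := fun n x => (T - Λ x) (reflectAt (ρ.kerP n) x)
  have hstep : ∀ x (n : ℕ), dist (H n x) (H (n + 1) x) ≤ C * 2 ^ γ * r ^ n := by
    intro x n
    have e1 : H (n + 1) x = H n x + (T - Λ x) (reflectAt (ρ.kerQ (n - 1)) x) := by
      simp only [H]
      rw [Nat.cast_add, Nat.cast_one, reflectAt_kerP_succ (by lia), map_add]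
    rw [dist_comm, e1, dist_eq_norm, add_sub_cancel_left]
    refine (hC (n - 1) (by lia) x).trans (le_of_eq ?_)
    rw [← hrn, mul_assoc, ← Real.rpow_add two_pos]
    push_cast
    ring_nf
  have hcau := fun x => cauchySeq_of_le_geometric r _ hr1 (hstep x)
  choose f hf using fun x => cauchySeq_tendsto_of_complete (hcau x)
  have hdist := fun x => dist_le_of_le_geometric_of_tendsto r _ hr1 (hstep x) (hf x)
  set C' := C * 2 ^ γ / (1 - r)
  have hC' : 0 ≤ C' := div_nonneg (by positivity) (by linarith)
  have hbd : ∀ (n : ℕ) x, ‖H n x - f x‖ ≤ C' * r ^ n := by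
    intro n x
    rw [← dist_eq_norm]
    refine (hdist x n).trans (le_of_eq ?_)
    simp only [C']
    ring
  have hHc : ∀ n, Continuous (H n) := by
    intro n
    have h1 := hTb.continuous_apply_reflectAt (ρ.bandLimited_symP n)
    rw [← kerP_eq] at h1
    exact h1.sub (h.continuous_apply_diag (by lia))
  have hunif : TendstoUniformly H f Filter.atTop := by
    rw [Metric.tendstoUniformly_iff]
    intro ε hε
    have ht : Filter.Tendsto (fun n : ℕ => C' * r ^ n) Filter.atTop (nhds 0) := by
      simpa using (tendsto_pow_atTop_nhds_zero_of_lt_one hr0.le hr1).const_mul C'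
    filter_upwards [ht.eventually (gt_mem_nhds hε)] with n hn x
    rw [dist_comm, dist_eq_norm]
    exact (hbd n x).trans_lt hn
  have hfc : Continuous f := hunif.continuous (Filter.Frequently.of_forall hHc)
  have hfb : ∀ x, ‖f x‖ ≤ C' := by
    intro x
    -- Since P_0 = 0, the rate of convergence at n = 0 is already a uniform bound on f.
    have h0 : H 0 x = 0 := by
      simp only [H]
      rw [reflectAt_kerP_of_nonpos (by simp), map_zero]
    simpa [h0] using hbd 0 x
  refine ⟨BoundedContinuousFunction.ofNormedAddCommGroup f hfc C' hfb, C', hC', hf, ?_⟩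
  intro n x
  rw [hrn]
  exact hbd n x

end RegularFamily

end DyadicPartition

end PositiveExponent


/-! ### The limit function as the unique correction in C^γ -/

section Correction

variable {d : ℕ}

local notation "𝔼" => EuclideanSpace ℝ (Fin d)

namespace DyadicPartition

variable {ρ : DyadicPartition d} {γ β₀ B : ℝ} {N : ℕ} {a : Fin N → ℝ}
  {Λ : EuclideanSpace ℝ (Fin d) → 𝓢'(EuclideanSpace ℝ (Fin d), ℂ)}
  {T : 𝓢'(EuclideanSpace ℝ (Fin d), ℂ)}

theorem HasBoundedBlocks.integral_kerQ_mul_kerP_eq_zero {S : 𝓢'(𝔼, ℂ)}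
    (hS : ρ.HasBoundedBlocks S) {k : ℤ} (hk : 0 ≤ k) (x : 𝔼) :
    ∫ z, ρ.kerQ k (x - z) * S (reflectAt (ρ.kerP k) z) = 0 := by
  have h1 := hS.apply_dualMult (ρ.bandLimited_symP k) (reflectAt (ρ.kerQ k) x)
  have h2 : dualMult (ρ.symP k) (reflectAt (ρ.kerQ k) x) = 0 := by
    refine schwartz_ext_fourierInv fun ξ => ?_
    rw [fourierInv_dualMult (SchwartzMap.hasTemperateGrowth _)]
    have hz : 𝓕⁻ (0 : 𝓢(𝔼, ℂ)) ξ = 0 := by simp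
    rw [hz]
    have : (0 : ℝ) < 2 ^ k := by positivity
    rcases le_total ‖ξ‖ (3 / 4 * 2 ^ k) with h2 | h2
    · rw [RegularFamily.fourierInv_reflectAt_kerQ_eq_zero_of_le hk x h2, mul_zero]
    · rw [ρ.symP_eq_zero k (by linarith), zero_mul]
  rw [h2, map_zero, ← kerP_eq] at h1
  rw [h1]
  simp only [reflectAt_apply]

theorem memHolder_of_convAt_le {f : 𝔼 →ᵇ ℂ} {C : ℝ} (hC0 : 0 ≤ C)
    (hC : ∀ k : ℤ, -1 ≤ k → ∀ x, ‖convAt (ρ.kerQ k) f x‖ ≤ C * 2 ^ (-(k : ℝ) * γ)) :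
    ρ.MemHolder γ (boundedDistribution f) := by
  have hf := representedBy_boundedDistribution f
  refine lt_of_le_of_lt (b := ENNReal.ofReal C) (iSup₂_le fun k hk => ?_) ENNReal.ofReal_lt_top
  have h1 := hf.fourierMultiplier (ρ.symQ k)
  have h2 : RepresentedBy (ρ.block k (boundedDistribution f)) (convAt (ρ.kerQ k) f)
      (C * 2 ^ (-(k : ℝ) * γ)) := ⟨h1.meas, hC k hk, h1.apply_eq⟩
  calc _ ≤ ENNReal.ofReal ((2 : ℝ) ^ (γ * k)) * ENNReal.ofReal (C * 2 ^ (-(k : ℝ) * γ)) := by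
        gcongr
        exact h2.linftyNorm_le (by positivity)
    _ = ENNReal.ofReal C := by
        rw [← ENNReal.ofReal_mul (by positivity), mul_left_comm, ← Real.rpow_add two_pos]
        ring_nf
        simp

/-- The P_n are an approximate identity, so P_{n+1} * f - f is minus the tail of the blocks Q_k * f,
k ≥ n, a geometric series when γ > 0. -/
theorem exists_norm_convAt_kerP_sub_le {f : 𝔼 →ᵇ ℂ} (hγ : 0 < γ) {C : ℝ} (hC0 : 0 ≤ C)
    (hC : ∀ k : ℤ, -1 ≤ k → ∀ x, ‖convAt (ρ.kerQ k) f x‖ ≤ C * 2 ^ (-(k : ℝ) * γ)) :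
    ∃ C', 0 ≤ C' ∧ ∀ (n : ℕ) x,
      ‖convAt (ρ.kerP (n + 1)) f x - f x‖ ≤ C' * 2 ^ (-((n + 1 : ℕ) : ℝ) * γ) := by
  have hf := representedBy_boundedDistribution f
  set r : ℝ := 2 ^ (-γ)
  have hr1 : r < 1 := Real.rpow_lt_one_of_one_lt_of_neg one_lt_two (by linarith)
  have hrn : ∀ n : ℕ, (2 : ℝ) ^ (-(n : ℝ) * γ) = r ^ n := by
    intro n
    rw [← Real.rpow_natCast, ← Real.rpow_mul two_pos.le]
    ring_nf
  have hstep : ∀ x (n : ℕ), dist (convAt (ρ.kerP (n + 1)) f x)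
      (convAt (ρ.kerP ((n + 1 : ℕ) + 1)) f x) ≤ C * r ^ n := by
    intro x n
    rw [← convAt_eq_apply hf, ← convAt_eq_apply hf, Nat.cast_add, Nat.cast_one,
      reflectAt_kerP_succ (n := (n : ℤ) + 1) (by lia), map_add, dist_comm, dist_eq_norm,
      add_sub_cancel_left, add_sub_cancel_right, convAt_eq_apply hf, ← hrn]
    simpa using hC n (by lia) x
  refine ⟨C / (1 - r) * 2 ^ γ, mul_nonneg (div_nonneg hC0 (by linarith)) (by positivity),
    fun n x => ?_⟩
  rw [← dist_eq_norm]
  refine (dist_le_of_le_geometric_of_tendsto r _ hr1 (hstep x)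
    (ρ.tendsto_convAt_kerP f x) n).trans (le_of_eq ?_)
  rw [mul_assoc, ← Real.rpow_add two_pos, ← hrn]
  push_cast
  ring_nf

namespace RegularFamily

/-- Averaging ⟨𝐏(Λ) - Λ_x, P_k(z - ·)⟩ over z against Q_k(x - z), with x frozen, gives 0 by
disjointness of spectra. Hence, for k ≥ 0, Q_k * f(x) only sees the error in replacing f(z) by its
k-th approximation and the increment Λ_x - Λ_z tested at z; both have size 2^{-kγ}. -/
theorem exists_norm_convAt_kerQ_le (h : ρ.RegularFamily γ β₀ a Λ B)
    (hTb : ρ.HasBoundedBlocks T) {f : 𝔼 →ᵇ ℂ} {C : ℝ} (hC0 : 0 ≤ C)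
    (hC : ∀ (n : ℕ) x,
      ‖(T - Λ x) (reflectAt (ρ.kerP n) x) - f x‖ ≤ C * 2 ^ (-(n : ℝ) * γ)) (hγ : 0 < γ) :
    ∃ C', 0 ≤ C' ∧ ∀ k : ℤ, -1 ≤ k → ∀ x,
      ‖convAt (ρ.kerQ k) f x‖ ≤ C' * 2 ^ (-(k : ℝ) * γ) := by
  obtain ⟨M, hM0, hM⟩ := ρ.exists_kernel_moments h.exponent_pos
  have hB := h.nonneg
  refine ⟨M * ‖f‖ + (M * C + B * ∑ _l : Fin N, M), by positivity, fun k hk x => ?_⟩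
  obtain ⟨-, m1, m2⟩ := hM k hk
  rcases lt_or_ge k 0 with hk0 | hk0
  -- For the block -1 the boundedness of f suffices, since 2^{-kγ} = 2^γ ≥ 1.
  · obtain rfl : k = -1 := by lia
    have h1 : (1 : ℝ) ≤ 2 ^ (-((-1 : ℤ) : ℝ) * γ) :=
      Real.one_le_rpow one_le_two (by push_cast; linarith)
    calc _ ≤ (∫ w, ‖ρ.kerQ (-1) w‖) * ‖f‖ :=
          norm_convAt_le (ρ.kerQ (-1)).integrable f.norm_coe_le_norm x
      _ ≤ M * ‖f‖ := by gcongr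
      _ ≤ M * ‖f‖ + (M * C + B * ∑ _l : Fin N, M) := le_add_of_nonneg_right (by positivity)
      _ ≤ _ := le_mul_of_one_le_right (by positivity) h1
  obtain ⟨n, rfl⟩ := Int.eq_ofNat_of_zero_le hk0
  set H : 𝔼 → ℂ := fun z => (T - Λ z) (reflectAt (ρ.kerP n) z)
  set t : ℝ := 2 ^ (-(n : ℝ) * γ)
  have iK : Integrable fun z => ρ.kerQ n (x - z) := (ρ.kerQ n).integrable.comp_sub_left x
  have cT := hTb.continuous_apply_reflectAt (ρ.bandLimited_symP n)
  have cΛ := (h.hasBoundedBlocks x).continuous_apply_reflectAt (ρ.bandLimited_symP n)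
  rw [← kerP_eq] at cT cΛ
  obtain ⟨bT, hbT⟩ := hTb.exists_bound_apply_reflectAt (ρ.bandLimited_symP n)
  obtain ⟨bΛ, hbΛ⟩ := (h.hasBoundedBlocks x).exists_bound_apply_reflectAt (ρ.bandLimited_symP n)
  rw [← kerP_eq] at hbT hbΛ
  have hHc : Continuous H := cT.sub (h.continuous_apply_diag (by lia))
  have iT := integrable_mul_of_bound iK cT.aestronglyMeasurable hbT
  have iΛ := integrable_mul_of_bound iK cΛ.aestronglyMeasurable hbΛ
  have iH : Integrable fun z => ρ.kerQ n (x - z) * (H z - f z) :=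
    integrable_mul_of_bound iK (hHc.sub f.continuous).aestronglyMeasurable (hC n)
  have if' : Integrable fun z => ρ.kerQ n (x - z) * f z :=
    integrable_mul_of_bound iK f.continuous.aestronglyMeasurable f.norm_coe_le_norm
  have e1 : convAt (ρ.kerQ n) f x =
      (∫ z, ρ.kerQ n (x - z) * (Λ x - Λ z) (reflectAt (ρ.kerP n) z)) -
        ∫ z, ρ.kerQ n (x - z) * (H z - f z) := by
    have e2 : ∀ z, ρ.kerQ n (x - z) * (Λ x - Λ z) (reflectAt (ρ.kerP n) z) =
        (ρ.kerQ n (x - z) * (H z - f z) + ρ.kerQ n (x - z) * f z) -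
          ρ.kerQ n (x - z) * T (reflectAt (ρ.kerP n) z) +
          ρ.kerQ n (x - z) * Λ x (reflectAt (ρ.kerP n) z) := by
      intro z
      change _ * (Λ x _ - Λ z _) = _ * (T _ - Λ z _ - f z) + _ - _ + _
      ring
    have iHf : Integrable fun z => ρ.kerQ n (x - z) * (H z - f z) + ρ.kerQ n (x - z) * f z :=
      iH.add if'
    have iHfT : Integrable fun z => ρ.kerQ n (x - z) * (H z - f z) + ρ.kerQ n (x - z) * f z -
        ρ.kerQ n (x - z) * T (reflectAt (ρ.kerP n) z) := iHf.sub iT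
    simp only [e2]
    rw [integral_add iHfT iΛ, integral_sub iHf iT, integral_add iH if', hTb.integral_kerQ_mul_kerP_eq_zero (by lia),
      (h.hasBoundedBlocks x).integral_kerQ_mul_kerP_eq_zero (by lia)]
    rw [convAt]
    ring
  have i0 : ∀ l, Integrable fun z => ‖ρ.kerQ n (x - z)‖ * ‖x - z‖ ^ a l := fun l =>
    (integrable_norm_mul_norm_rpow (ρ.kerQ n) (h.exponent_pos l).le).comp_sub_left x
  have i1 : ∀ l, Integrable fun z =>
      B * (‖ρ.kerQ n (x - z)‖ * ‖x - z‖ ^ a l * 2 ^ (-(n : ℝ) * (γ - a l))) := fun l =>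
    ((i0 l).mul_const _).const_mul _
  have b1 : ‖∫ z, ρ.kerQ n (x - z) * (Λ x - Λ z) (reflectAt (ρ.kerP n) z)‖ ≤
      B * (∑ _l : Fin N, M) * t := by
    calc _ ≤ ∫ z, ∑ l, B * (‖ρ.kerQ n (x - z)‖ * ‖x - z‖ ^ a l * 2 ^ (-(n : ℝ) * (γ - a l))) := by
          refine norm_integral_le_of_norm_le (integrable_finsetSum _ fun l _ => i1 l)
            (Filter.Eventually.of_forall fun z => ?_)
          rw [norm_mul]
          refine (mul_le_mul_of_nonneg_left (h.osc_kerP x z n (by lia)) (norm_nonneg _)).trans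
            (le_of_eq ?_)
          rw [Finset.mul_sum, Finset.mul_sum]
          refine Finset.sum_congr rfl fun l _ => ?_
          push_cast
          ring
      _ = ∑ l, B * ((∫ w, ‖ρ.kerQ n w‖ * ‖w‖ ^ a l) * 2 ^ (-(n : ℝ) * (γ - a l))) := by
          rw [integral_finsetSum _ fun l _ => i1 l]
          refine Finset.sum_congr rfl fun l _ => ?_
          rw [integral_const_mul, integral_mul_const,
            integral_sub_left_eq_self (fun w => ‖ρ.kerQ n w‖ * ‖w‖ ^ a l) volume x]
      _ ≤ ∑ l, B * (M * 2 ^ (-(n : ℝ) * a l) * 2 ^ (-(n : ℝ) * (γ - a l))) := by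
          gcongr with l
          exact m2 l
      _ = _ := by
          rw [mul_assoc B, Finset.sum_mul, Finset.mul_sum]
          refine Finset.sum_congr rfl fun l _ => ?_
          rw [mul_assoc M, ← Real.rpow_add two_pos]
          simp only [t]
          ring_nf
  have b2 : ‖∫ z, ρ.kerQ n (x - z) * (H z - f z)‖ ≤ M * C * t := by
    refine (norm_integral_mul_le iK (hC n)).trans ?_
    rw [integral_sub_left_eq_self (fun w => ‖ρ.kerQ n w‖) volume x, mul_assoc]
    gcongr
  rw [e1]
  have e3 : (2 : ℝ) ^ (-((n : ℤ) : ℝ) * γ) = t := by simp [t]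
  have ht : 0 ≤ t := by positivity
  have : 0 ≤ M * ‖f‖ * t := by positivity
  rw [e3]
  refine (norm_sub_le _ _).trans ?_
  nlinarith [add_le_add b1 b2]

theorem exists_correction (h : ρ.RegularFamily γ β₀ a Λ B)
    (hT : ρ.IsParaproduct Λ T) (hTb : ρ.HasBoundedBlocks T) (hγ : 0 < γ) :
    ∃ f : 𝔼 →ᵇ ℂ, ρ.MemHolder γ (boundedDistribution f) ∧
      ρ.Reconstructs γ Λ (T - boundedDistribution f) ∧
      (∀ g : 𝓢'(𝔼, ℂ), ρ.MemHolder γ g → ρ.Reconstructs γ Λ (T - g) →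
        g = boundedDistribution f) ∧
      ((∀ x, IsRealDistribution (Λ x)) → ∀ x, (f x).im = 0) := by
  obtain ⟨f, C, hC0, hlim, hC⟩ := h.exists_limit hT hTb hγ
  have hf := representedBy_boundedDistribution f
  obtain ⟨C₁, hC₁0, hC₁⟩ := h.exists_norm_convAt_kerQ_le hTb hC0 hC hγ
  obtain ⟨C₂, hC₂0, hC₂⟩ := exists_norm_convAt_kerP_sub_le hγ hC₁0 hC₁
  have hrec : ρ.Reconstructs γ Λ (T - boundedDistribution f) := by
    refine ⟨C + C₂, fun x i hi => ?_⟩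
    rcases le_or_gt i 0 with hi0 | hi0
    · rw [reflectAt_kerP_of_nonpos hi0, map_zero, norm_zero]
      positivity
    · obtain ⟨n, rfl⟩ : ∃ n : ℕ, i = n + 1 := ⟨(i - 1).toNat, by lia⟩
      -- Inserting f(x) splits the error into the rate of convergence to f(x) and the smoothing
      -- error of f, each O(2^{-iγ}).
      have e1 : (T - boundedDistribution f - Λ x) (reflectAt (ρ.kerP (n + 1)) x) =
          ((T - Λ x) (reflectAt (ρ.kerP ((n + 1 : ℕ) : ℤ)) x) - f x) -
            (convAt (ρ.kerP (n + 1)) f x - f x) := by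
        rw [← convAt_eq_apply hf, Nat.cast_add, Nat.cast_one]
        change T _ - boundedDistribution f _ - Λ x _ = (T _ - Λ x _ - f x) - _
        ring
      rw [e1, add_mul]
      refine (norm_sub_le _ _).trans (add_le_add ?_ ?_)
      · simpa using hC (n + 1) x
      · simpa using hC₂ n x
  refine ⟨f, memHolder_of_convAt_le hC₁0 hC₁, hrec, fun g hg hgrec => ?_, fun hreal x => ?_⟩
  · obtain ⟨D, hD⟩ := hgrec
    obtain ⟨D', hD'⟩ := hrec
    have hgb : ρ.HasBoundedBlocks g :=
      hasBoundedBlocks_of_holderNorm_le (ENNReal.coe_toNNReal hg.ne).ge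
    have hbb : ρ.HasBoundedBlocks (g - boundedDistribution f) :=
      hgb.sub (hasBoundedBlocks_of_representedBy hf)
    have hr1 : (2 : ℝ) ^ (-γ) < 1 :=
      Real.rpow_lt_one_of_one_lt_of_neg one_lt_two (by linarith)
    have ht : Filter.Tendsto (fun n : ℕ => (D' + D) * ((2 : ℝ) ^ (-γ)) ^ (n + 1)) Filter.atTop
        (nhds 0) := by
      have := ((tendsto_pow_atTop_nhds_zero_of_lt_one (by positivity) hr1).comp
        (Filter.tendsto_add_atTop_nat 1)).const_mul (D' + D)
      simpa using this
    refine sub_eq_zero.1 (eq_zero_of_tendsto hbb ht fun n x => ?_)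
    -- The terms in T and Λ_x cancel between the two reconstruction bounds, so the truncations of
    -- the difference are O(2^{-nγ}) uniformly in x.
    have e1 : (g - boundedDistribution f) (reflectAt (ρ.kerP (n + 1)) x) =
        (T - boundedDistribution f - Λ x) (reflectAt (ρ.kerP (n + 1)) x) -
          (T - g - Λ x) (reflectAt (ρ.kerP (n + 1)) x) := by
      change g _ - boundedDistribution f _ =
        (T _ - boundedDistribution f _ - Λ x _) - (T _ - g _ - Λ x _)
      ring
    have e2 : ((2 : ℝ) ^ (-γ)) ^ (n + 1) = 2 ^ (-(((n : ℤ) + 1 : ℤ) : ℝ) * γ) := by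
      rw [← Real.rpow_natCast, ← Real.rpow_mul two_pos.le]
      push_cast
      ring_nf
    rw [e1, e2, add_mul]
    exact (norm_sub_le _ _).trans (add_le_add (hD' x _ (by lia)) (hD x _ (by lia)))
  · have h1 := (Complex.continuous_im.tendsto (f x)).comp (hlim x)
    refine tendsto_nhds_unique h1 ?_
    have h2 : (Complex.im ∘ fun n : ℕ => (T - Λ x) (reflectAt (ρ.kerP n) x)) = fun _ => 0 := by
      funext n
      have hker : ∀ y, (reflectAt (ρ.kerP n) x y).im = 0 := fun y => by
        rw [reflectAt_apply]; exact ρ.im_kerP _ _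
      change (T _ - Λ x _).im = 0
      rw [Complex.sub_im, hT.isRealDistribution hreal _ hker, hreal x _ hker, sub_zero]
    rw [h2]
    exact tendsto_const_nhds

end RegularFamily

end DyadicPartition

end Correction

end

theorem mainTheorem4 {d : ℕ} (ρ : DyadicPartition d) (γ β₀ : ℝ)
    (Λ : EuclideanSpace ℝ (Fin d) → 𝓢'(EuclideanSpace ℝ (Fin d), ℂ))
    (hΛ : ∃ C : NNReal, ∀ x, ρ.holderNorm β₀ (Λ x) ≤ C)
    (N : ℕ) (β : Fin N → ℝ) (hβ : ∀ l, β l < γ)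
    (c : Fin N → EuclideanSpace ℝ (Fin d) → EuclideanSpace ℝ (Fin d) → ℝ)
    (Θ : Fin N → EuclideanSpace ℝ (Fin d) → 𝓢'(EuclideanSpace ℝ (Fin d), ℂ))
    (hc_meas : ∀ l, Measurable (Function.uncurry (c l)))
    (hdec : ∀ x y, Λ y - Λ x = ∑ l, (c l y x : ℂ) • Θ l x)
    (hΘ : ∀ l, ∃ C : ℝ, ∀ x, ∀ j : ℤ, -1 ≤ j →
      (2 : ℝ) ^ ((j : ℝ) * β l) * ‖Θ l x (reflectAt (ρ.kerP j) x)‖ ≤ C)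
    (hc : ∀ l, ∃ C : ℝ, ∀ y x, |c l y x| ≤ C * ‖y - x‖ ^ (γ - β l)) :
    ∃ PΛ : 𝓢'(EuclideanSpace ℝ (Fin d), ℂ), ρ.IsParaproduct Λ PΛ ∧
      (0 < γ → ∃ f : EuclideanSpace ℝ (Fin d) →ᵇ ℂ,
        ρ.MemHolder γ (boundedDistribution f) ∧
        ρ.Reconstructs γ Λ (PΛ - boundedDistribution f) ∧
        (∀ g : 𝓢'(EuclideanSpace ℝ (Fin d), ℂ), ρ.MemHolder γ g →
          ρ.Reconstructs γ Λ (PΛ - g) → g = boundedDistribution f) ∧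
        ((∀ x, IsRealDistribution (Λ x)) → ∀ x, (f x).im = 0)) ∧
      (γ < 0 → ρ.Reconstructs γ Λ PΛ) := by
  obtain ⟨B, h⟩ := DyadicPartition.exists_regularFamily hΛ hβ hdec hΘ hc
  obtain ⟨T, hT, hTb⟩ := h.exists_isParaproduct
  exact ⟨T, hT, h.exists_correction hT hTb, h.reconstructs_of_neg hT⟩
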